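/- Consider a MIMO-OFDM system with $N\ge 1$ subcarriers, $N_t$ transmit and $N_r$ receive antennas, SNR $\gamma>0$ and channel length $L$. The power delay profile $\sigma_0,\dots,\sigma_{L-1}\in\mathbb R$ satisfies $\sum_{p=0}^{L-1}\sigma_p^2=1$. The entries of the $N_r\times N_t$ random matrices $\mathbf H[0],\dots,\mathbf H[L-1]$ are all mutually independent with law $\mathcal{CN}(0,1)$ (independent real and imaginary parts, each $\mathcal N(0,\tfrac12)$). For $k=0,\dots,N-1$ put $$\mathbf H_k=\sum_{p=0}^{L-1}\sigma_p\,\mathbf H[p]\,e^{-\mathrm j 2\pi kp/N},\qquad \mathcal I_k=\log_2\det\Bigl(\mathbf I_{N_r}+\frac{\gamma}{N_t}\mathbf H_k\mathbf H_k^\dagger\Bigr),\qquad \mathcal I_{\rm ofdm}=\frac1N\sum_{k=0}^{N-1}\mathcal I_k .$$ Let $\rho_d=\sum_{p=0}^{L-1}\sigma_p^2e^{-\mathrm j2\pi dp/N}$; this is the frequency correlation coefficient, that is, $E[(\mathbf H_k)_{i,j}(\mathbf H_\ell)_{i',j'}^*]=\rho_{k-\ell}\,\delta_{i,i'}\delta_{j,j'}$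 for all $k,\ell,i,j,i',j'$. Suppose the system is SIMO or MISO, i.e. $\min(N_r,N_t)=1$ and $n=\max(N_r,N_t)>1$. Then $\mathcal I_{\rm ofdm}$ is square integrable and $$\begin{aligned}{\rm Var}(\mathcal I_{\rm ofdm})=\frac{(\log_2 e)^2}{\Gamma(n)}\biggl(&\frac{2}{N^2}\sum_{d=1}^{N-1}(N-d)\,\varphi(\rho_d)-\Gamma(n)\,e^{2N_t/\gamma}\,(g_1(n))^2\\&+\frac{2e^{N_t/\gamma}}{N}\Bigl(\frac{N_t}{\gamma}\Bigr)^{n}\sum_{t=0}^{n-1}\binom{n-1}{t}(-1)^{n-1-t}\,G^{4,0}_{3,4}\Bigl(\tfrac{N_t}{\gamma}\Big|{}^{-t,\,-t,\,-t}_{0,\,-t-1,\,-t-1,\,-t-1}\Bigr)\biggr),\end{aligned}$$ where $$\varphi(\rho_d)=\begin{cases}\Gamma(n)\,e^{2N_t/\gamma}(g_1(n))^2,&|\rho_d|=0,\\[4pt](1-|\rho_d|^2)^n\,e^{\frac{2N_t}{\gamma(1-|\rho_d|^2)}}\displaystyle\sum_{t=0}^{\infty}\frac{|\rho_d|^{2t}\,\Gamma(n+t)\,(g_2(n+t))^2}{t!},&0<|\rho_d|<1,\\[8pt]2e^{N_t/\gamma}\Bigl(\dfrac{N_t}{\gamma}\Bigr)^{n}\displaystyle\sum_{t=0}^{n-1}\binom{n-1}{t}(-1)^{n-1-t}\,G^{4,0}_{3,4}\Bigl(\tfrac{N_t}{\gamma}\Big|{}^{-t,\,-t,\,-t}_{0,\,-t-1,\,-t-1,\,-t-1}\Bigr),&|\rho_d|=1,\end{cases}$$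 the infinite series being convergent. Here $$g_1(z)=\sum_{h=1}^{z}E_h\Bigl(\frac{N_t}{\gamma}\Bigr),\qquad g_2(z)=\sum_{h=1}^{z}E_h\Bigl(\frac{N_t}{\gamma(1-|\rho_d|^2)}\Bigr),\qquad E_h(x)=\int_1^\infty \frac{e^{-xt}}{t^h}\,dt$$ ($E_h$ is the exponential integral), and $G^{4,0}_{3,4}$ is the Meijer $G$-function, given by its Mellin–Barnes integral $$G^{4,0}_{3,4}\Bigl(x\Big|{}^{a_1,a_2,a_3}_{b_1,b_2,b_3,b_4}\Bigr)=\frac1{2\pi \mathrm i}\int_{c-\mathrm i\infty}^{c+\mathrm i\infty}\frac{\prod_{j=1}^4\Gamma(b_j-s)}{\prod_{j=1}^3\Gamma(a_j-s)}\,x^s\,ds,\qquad x>0,\quad c<\min_j \operatorname{Re} b_j .$$ -/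

import Mathlib

namespace OFDM

open MeasureTheory ProbabilityTheory

noncomputable section

/-! Special functions -/

/-- The exponential integral `E_h(x) = ∫_1^∞ e^{-x t} t^{-h} dt`, for `h : ℕ` and `x > 0`. -/
def expIntegral (h : ℕ) (x : ℝ) : ℝ :=
  ∫ t in Set.Ioi (1 : ℝ), Real.exp (-x * t) / t ^ h

/-- The integrand of the Mellin-Barnes integral of the Meijer function `G_{p,q}^{m,n}`:
`∏_{j ≤ m} Γ(b_j - s) ∏_{j ≤ n} Γ(1 - a_j + s) z^s`
divided by `∏_{m < j ≤ q} Γ(1 - b_j + s) ∏_{n < j ≤ p} Γ(a_j - s)`. -/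
def meijerIntegrand (m n : ℕ) {p q : ℕ} (a : Fin p → ℂ) (b : Fin q → ℂ) (z s : ℂ) : ℂ :=
  ((∏ j ∈ Finset.univ.filter (fun j : Fin q => (j : ℕ) < m), Complex.Gamma (b j - s)) *
      (∏ j ∈ Finset.univ.filter (fun j : Fin p => (j : ℕ) < n), Complex.Gamma (1 - a j + s))) /
    ((∏ j ∈ Finset.univ.filter (fun j : Fin q => m ≤ (j : ℕ)), Complex.Gamma (1 - b j + s)) *
      (∏ j ∈ Finset.univ.filter (fun j : Fin p => n ≤ (j : ℕ)), Complex.Gamma (a j - s))) * z ^ s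

/-- The line `Re s = c` separates the poles of the `Γ(b_j - s)`, `j ≤ m`, which lie to its right,
from those of the `Γ(1 - a_j + s)`, `j ≤ n`, which lie to its left. -/
def MeijerSeparates (m n : ℕ) {p q : ℕ} (a : Fin p → ℂ) (b : Fin q → ℂ) (c : ℝ) : Prop :=
  (∀ j : Fin q, (j : ℕ) < m → c < (b j).re) ∧ (∀ j : Fin p, (j : ℕ) < n → (a j).re - 1 < c)

open Classical in
/-- The Meijer function
`G_{p,q}^{m,n}(z | a_1, …, a_p ; b_1, …, b_q) = (1 / 2πi) ∫ meijerIntegrand ds`,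
the contour being a line from `c - i∞` to `c + i∞` that separates the two families of poles
(by Cauchy's theorem the value does not depend on `c` where the integrand decays, that is for
`p + q < 2 (m + n)` and `|arg z| < (m + n - (p + q) / 2) π`).  Along the line `ds = i dy`. -/
def meijerG (m n : ℕ) {p q : ℕ} (a : Fin p → ℂ) (b : Fin q → ℂ) (z : ℂ) : ℂ :=
  if h : ∃ c : ℝ, MeijerSeparates m n a b c then
    1 / (2 * (Real.pi : ℂ)) *
      ∫ y : ℝ, meijerIntegrand m n a b z ((h.choose : ℂ) + (y : ℂ) * Complex.I)
  else 0

/-! Channel model -/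

/-- The circularly symmetric complex Gaussian law `CN(0,1)`: real and imaginary parts are
independent, centred, of variance `1/2`. -/
def stdComplexGaussian : Measure ℂ :=
  ((gaussianReal 0 (1 / 2)).prod (gaussianReal 0 (1 / 2))).map
    Complex.measurableEquivRealProd.symm

/-- `H[0], …, H[L-1]` is a spatially uncorrelated Rayleigh channel impulse response: all entries of
all taps are `CN(0,1)` and independent. -/
structure IsRayleighChannel {Ω : Type*} [MeasurableSpace Ω] (μ : Measure Ω) {L Nr Nt : ℕ}
    (H : Fin L → Ω → Matrix (Fin Nr) (Fin Nt) ℂ) : Prop where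
  hasLaw : ∀ p i j, HasLaw (fun ω => H p ω i j) stdComplexGaussian μ
  indep : iIndepFun (fun (x : Fin L × Fin Nr × Fin Nt) ω => H x.1 ω x.2.1 x.2.2) μ

/-- The channel matrix `H_k = ∑_p σ_p H[p] exp(-j 2π k p / N)` of subcarrier `k`. -/
def subcarrier (N : ℕ) {L Nr Nt : ℕ} (σ : Fin L → ℝ) (H : Fin L → Matrix (Fin Nr) (Fin Nt) ℂ)
    (k : ℕ) : Matrix (Fin Nr) (Fin Nt) ℂ :=
  ∑ p : Fin L, ((σ p : ℂ) *
    Complex.exp (-Complex.I * (2 * Real.pi * (k / N : ℝ) * (p : ℕ) : ℝ))) • H p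

/-- The frequency correlation coefficient `ρ_d = ∑_p σ_p² exp(-j 2π d p / N)`. -/
def freqCorr (N : ℕ) {L : ℕ} (σ : Fin L → ℝ) (d : ℤ) : ℂ :=
  ∑ p : Fin L, ((σ p : ℂ) ^ 2) *
    Complex.exp (-Complex.I * (2 * Real.pi * d * (p : ℕ) / N : ℝ))

/-- The mutual information `log₂ det (I + (γ / N_t) G G†)` of one channel matrix `G`.
(The determinant is a positive real number, see `det_pos`.) -/
def mutualInfo {Nr Nt : ℕ} (γ : ℝ) (G : Matrix (Fin Nr) (Fin Nt) ℂ) : ℝ :=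
  Real.logb 2 (Matrix.det (1 + ((γ / Nt : ℝ) : ℂ) • (G * G.conjTranspose))).re

/-- The mutual information `(1/N) ∑_k I_k` of the OFDM system. -/
def ofdmMutualInfo (N : ℕ) {L Nr Nt : ℕ} (γ : ℝ) (σ : Fin L → ℝ)
    (H : Fin L → Matrix (Fin Nr) (Fin Nt) ℂ) : ℝ :=
  1 / N * ∑ k ∈ Finset.range N, mutualInfo γ (subcarrier N σ H k)

open scoped ComplexOrder in
theorem det_pos {Nr Nt : ℕ} {γ : ℝ} (hγ : 0 < γ) (G : Matrix (Fin Nr) (Fin Nt) ℂ) :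
    0 < (Matrix.det (1 + ((γ / Nt : ℝ) : ℂ) • (G * G.conjTranspose))).re ∧
      (Matrix.det (1 + ((γ / Nt : ℝ) : ℂ) • (G * G.conjTranspose))).im = 0 := by
  have h : (1 + ((γ / Nt : ℝ) : ℂ) • (G * G.conjTranspose)).PosDef :=
    Matrix.PosDef.one.add_posSemidef
      ((Matrix.posSemidef_self_mul_conjTranspose G).smul
        (by exact_mod_cast (by positivity : (0 : ℝ) ≤ γ / Nt)))
  have h2 := Complex.lt_def.1 h.det_pos
  exact ⟨h2.1, h2.2.symm⟩

theorem norm_freqCorr_le_one (N : ℕ) {L : ℕ} (σ : Fin L → ℝ) (hσ : ∑ p, σ p ^ 2 = 1) (d : ℤ) :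
    ‖freqCorr N σ d‖ ≤ 1 := by
  rw [← hσ]
  refine (norm_sum_le _ _).trans (Finset.sum_le_sum fun p _ => ?_)
  rw [norm_mul, norm_pow, Complex.norm_real, Complex.norm_exp]
  simp

/-! The functions that enter the variance formula -/

/-- `g_1(z) = ∑_{h=1}^z E_h(N_t / γ)`. -/
def g₁ (Nt : ℕ) (γ : ℝ) (z : ℕ) : ℝ :=
  ∑ h ∈ Finset.Icc 1 z, expIntegral h (Nt / γ)

/-- `g_2(z) = ∑_{h=1}^z E_h(N_t / (γ (1 - |ρ|²)))`. -/
def g₂ (Nt : ℕ) (γ : ℝ) (ρ : ℂ) (z : ℕ) : ℝ :=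
  ∑ h ∈ Finset.Icc 1 z, expIntegral h (Nt / (γ * (1 - ‖ρ‖ ^ 2)))

/-- The sum
`∑_{t=0}^{n-1} binom(n-1,t) (-1)^{n-1-t} G_{3,4}^{4,0}(N_t/γ | -t,-t,-t ; 0,-t-1,-t-1,-t-1)`. -/
def meijerSum (Nt n : ℕ) (γ : ℝ) : ℂ :=
  ∑ t ∈ Finset.range n, ((n - 1).choose t : ℂ) * (-1) ^ (n - 1 - t) *
    meijerG 4 0 ![-(t : ℂ), -(t : ℂ), -(t : ℂ)]
      ![0, -(t : ℂ) - 1, -(t : ℂ) - 1, -(t : ℂ) - 1] ((Nt / γ : ℝ) : ℂ)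

/-- The `t`-th term `|ρ|^{2t} Γ(n+t) g_2(n+t)² / t!` of the series in `φ(ρ)`, `0 < |ρ| < 1`. -/
def phiTerm (Nt n : ℕ) (γ : ℝ) (ρ : ℂ) (t : ℕ) : ℝ :=
  ‖ρ‖ ^ (2 * t) * Real.Gamma (n + t) * g₂ Nt γ ρ (n + t) ^ 2 / (t.factorial : ℝ)

open Classical in
/-- The function `φ(ρ)`; the three cases are `|ρ| = 0`, `0 < |ρ| < 1` and `|ρ| = 1`
(for a correlation coefficient `|ρ| ≤ 1`, see `norm_freqCorr_le_one`). -/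
def phi (Nt n : ℕ) (γ : ℝ) (ρ : ℂ) : ℂ :=
  if ‖ρ‖ = 0 then
    ((Real.Gamma n * Real.exp (2 * Nt / γ) * g₁ Nt γ n ^ 2 : ℝ) : ℂ)
  else if ‖ρ‖ < 1 then
    (((1 - ‖ρ‖ ^ 2) ^ n * Real.exp (2 * Nt / (γ * (1 - ‖ρ‖ ^ 2))) *
      ∑' t : ℕ, phiTerm Nt n γ ρ t : ℝ) : ℂ)
  else
    ((2 * Real.exp (Nt / γ) * (Nt / γ) ^ n : ℝ) : ℂ) * meijerSum Nt n γ

end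

end OFDM

namespace OFDM

open MeasureTheory ProbabilityTheory Filter Set Topology

/-! Put β = N_t/γ. When min(N_r, N_t) = 1 the determinant collapses to 1 + X_k/β, where X_k is the
sum of the squared moduli of the n entries of H_k (`det_one_add_smul_of_min_eq_one`). The variance
is thus a double sum over (k, l) of E[log(1 + X_k/β) log(1 + X_l/β)] minus a squared mean, and the
task is to find the joint law of (X_k, X_l).

The entries of (H_k, H_l) form n independent pairs of unit complex Gaussians with correlation ρ =
ρ_{l-k}. With r = |ρ|², iterated Gaussian integrals give the characteristic function (1 - ia - ib -
(1-r)ab)^{-n} of (X_k, X_l) (`integral_cexp_norm_sq_pair`, `integral_cexp_sum_norm_sq`). If r < 1,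
set A = λ/(λ - ia), B = λ/(λ - ib), λ = 1/(1-r). The function equals ((1-r)AB/(1 - rAB))^n, and the
negative binomial series expands it in powers (AB)^{n+t}. So the law is a mixture of products of two
equal Gamma laws of shape n+t and rate λ (`map_sum_norm_sq_eq_gammaMixture`), and E[f(X_k) f(X_l)]
is a weighted sum of squares of Gamma means. For f(x) = log(1 + x/β), integration by parts yields
e^{βλ} times a sum of exponential integrals (`integral_log_gammaMeasure`), whence the series in φ.
Its convergence comes with integrability of the product of logarithms. For ρ = 0 only the term t = 0
survives.

If r = 1 the joint law lies on the diagonal, and the second moment of log(1 + x/β) under Gamma(n, 1)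
is required. With u = 1 + x/β and (u-1)^{n-1} expanded, it becomes a combination of Laplace
integrals of (log u)² u^t. Their Mellin transform is 2Γ(w)/(w - t - 1)³, and Mellin inversion along
w = -s turns them into the Meijer functions (`meijerG_eq_logSqLaplace`).

Finally φ depends on ρ only through |ρ|, and |ρ_{-d}| = |ρ_d|. The double sum is therefore of
symmetric Toeplitz type, with N - d pairs at each distance d on either side of the diagonal and with
ρ_0 = 1 on it. -/

/-- The affine change of variables `u = 1 + x / β` on a half-line. -/
lemma integral_Ioi_comp_one_add_div {E : Type*} [NormedAddCommGroup E] [NormedSpace ℝ E]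
    (g : ℝ → E) {β : ℝ} (hβ : 0 < β) :
    ∫ x in Ioi (0 : ℝ), g (1 + x / β) = β • ∫ u in Ioi (1 : ℝ), g u := by
  have h1 := integral_comp_mul_left_Ioi (fun x => g (1 + x)) 0 (inv_pos.2 hβ)
  have h2 : ∫ x in Ioi (0 : ℝ), g (1 + x) = ∫ u in Ioi (1 : ℝ), g u := by
    have := (measurePreserving_add_left (volume : Measure ℝ) 1).setIntegral_preimage_emb
      (MeasurableEquiv.addLeft (1 : ℝ)).measurableEmbedding g (Ioi 1)
    rw [← this]
    congr 2
    ext x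
    simp
  simp only [mul_zero, inv_inv] at h1
  rw [← h2, ← h1]
  congr 1
  ext x
  rw [div_eq_inv_mul]

/-! ### Gamma integrals and Gamma laws of integer shape -/

lemma integrableOn_pow_mul_exp_neg (m : ℕ) {l : ℝ} (hl : 0 < l) :
    IntegrableOn (fun x : ℝ => x ^ m * Real.exp (-(l * x))) (Ioi 0) := by
  have h := integrableOn_rpow_mul_exp_neg_mul_rpow (p := 1) (s := m) (b := l)
    (by have : (0 : ℝ) ≤ m := by positivity
        linarith) one_pos hl
  refine h.congr_fun (fun x _ => ?_) measurableSet_Ioi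
  simp

lemma integral_pow_mul_exp_neg (m : ℕ) {l : ℝ} (hl : 0 < l) :
    ∫ x in Ioi (0 : ℝ), x ^ m * Real.exp (-(l * x)) = m.factorial / l ^ (m + 1) := by
  have h := Real.integral_rpow_mul_exp_neg_mul_Ioi (a := m + 1) (r := l) (by positivity) hl
  rw [Real.Gamma_nat_eq_factorial] at h
  rw [div_eq_inv_mul, ← one_div, ← one_div_pow]
  convert h using 1
  · refine setIntegral_congr_fun measurableSet_Ioi fun x _ => ?_
    simp
  · norm_cast

lemma tendsto_pow_mul_exp_neg (m : ℕ) {l : ℝ} (hl : 0 < l) :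
    Tendsto (fun x : ℝ => x ^ m * Real.exp (-(l * x))) atTop (𝓝 0) := by
  simpa using tendsto_rpow_mul_exp_neg_mul_atTop_nhds_zero m l hl

/-- The density of the Gamma law of shape `m + 1` and rate `l`. -/
noncomputable def gammaDensity (m : ℕ) (l x : ℝ) : ℝ :=
  l ^ (m + 1) / m.factorial * (x ^ m * Real.exp (-(l * x)))

lemma integral_gammaMeasure {E : Type*} [NormedAddCommGroup E] [NormedSpace ℝ E] (f : ℝ → E)
    (m : ℕ) {l : ℝ} (hl : 0 < l) :
    ∫ x, f x ∂gammaMeasure (m + 1 : ℕ) l = ∫ x in Ioi (0 : ℝ), gammaDensity m l x • f x := by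
  rw [gammaMeasure, integral_withDensity_eq_integral_toReal_smul
    (show Measurable (gammaPDF _ _) from (measurable_gammaPDFReal _ _).ennreal_ofReal) (ae_of_all _ fun x => by simp [gammaPDF])]
  rw [← integral_Ici_eq_integral_Ioi, ← integral_indicator measurableSet_Ici]
  congr 1
  ext x
  by_cases hx : 0 ≤ x
  · rw [indicator_of_mem (by exact hx), gammaPDF,
      ENNReal.toReal_ofReal (gammaPDFReal_nonneg (by positivity) hl x), gammaPDFReal, if_pos hx,
      gammaDensity]
    congr 1
    push_cast
    rw [Real.Gamma_nat_eq_factorial, add_sub_cancel_right, Real.rpow_natCast, ← mul_assoc]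
    norm_cast
  · rw [indicator_of_notMem (by simpa using hx), gammaPDF, gammaPDFReal, if_neg hx]
    simp

lemma integrable_gammaMeasure_iff {E : Type*} [NormedAddCommGroup E] [NormedSpace ℝ E] (f : ℝ → E)
    (m : ℕ) {l : ℝ} (hl : 0 < l) :
    Integrable f (gammaMeasure (m + 1 : ℕ) l) ↔
      IntegrableOn (fun x => gammaDensity m l x • f x) (Ioi (0 : ℝ)) := by
  rw [gammaMeasure, integrable_withDensity_iff_integrable_smul'
    (show Measurable (gammaPDF _ _) from (measurable_gammaPDFReal _ _).ennreal_ofReal) (ae_of_all _ fun x => by simp [gammaPDF]),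
    ← integrableOn_Ici_iff_integrableOn_Ioi, ← integrable_indicator_iff measurableSet_Ici]
  congr! 1
  ext x
  by_cases hx : 0 ≤ x
  · rw [indicator_of_mem (by exact hx), gammaPDF,
      ENNReal.toReal_ofReal (gammaPDFReal_nonneg (by positivity) hl x), gammaPDFReal, if_pos hx,
      gammaDensity]
    congr 1
    push_cast
    rw [Real.Gamma_nat_eq_factorial, add_sub_cancel_right, Real.rpow_natCast, ← mul_assoc]
    norm_cast
  · rw [indicator_of_notMem (by simpa using hx), gammaPDF, gammaPDFReal, if_neg hx]
    simp

/-! The exponential integral -/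

lemma integrableOn_exp_neg_div_pow (h : ℕ) {y : ℝ} (hy : 0 < y) :
    IntegrableOn (fun t : ℝ => Real.exp (-y * t) / t ^ h) (Ioi 1) := by
  have h0 : IntegrableOn (fun t : ℝ => Real.exp (-y * t)) (Ioi 1) := by
    simpa using integrableOn_exp_mul_Ioi (a := -y) (by linarith) 1
  refine Integrable.mono' h0 (by fun_prop : Measurable _).aestronglyMeasurable ?_
  refine (ae_restrict_iff' measurableSet_Ioi).2 (ae_of_all _ fun t (ht : 1 < t) => ?_)
  rw [Real.norm_of_nonneg (by positivity)]
  exact div_le_self (Real.exp_pos _).le (one_le_pow₀ ht.le)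

/-- Integration by parts: -e^{-yt}/t^{m+1} has as derivative the sum of the two integrands and
vanishes at infinity. -/
lemma expIntegral_succ (m : ℕ) {y : ℝ} (hy : 0 < y) :
    (m + 1) * expIntegral (m + 2) y = Real.exp (-y) - y * expIntegral (m + 1) y := by
  have hI1 := integrableOn_exp_neg_div_pow (m + 1) hy
  have hI2 := integrableOn_exp_neg_div_pow (m + 2) hy
  have key : ∫ t in Ioi (1 : ℝ), (y * (Real.exp (-y * t) / t ^ (m + 1)) +
      (m + 1) * (Real.exp (-y * t) / t ^ (m + 2))) =
      0 - (-(Real.exp (-y * 1) / 1 ^ (m + 1))) := by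
    refine integral_Ioi_of_hasDerivAt_of_tendsto' (f := fun t => -(Real.exp (-y * t) / t ^ (m + 1)))
      (fun t ht => ?_) ((hI1.const_mul y).add (hI2.const_mul _)) ?_
    · have ht0 : (0 : ℝ) < t := lt_of_lt_of_le one_pos ht
      have h1 : HasDerivAt (fun t => Real.exp (-y * t)) (Real.exp (-y * t) * -y) t := by
        simpa using ((hasDerivAt_id t).const_mul (-y)).exp
      have h2 := hasDerivAt_pow (m + 1) t
      refine (h1.div h2 (by positivity)).neg.congr_deriv ?_
      push_cast
      field_simp
      ring
    · have h3 : Tendsto (fun t : ℝ => Real.exp (-y * t)) atTop (𝓝 0) := by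
        simpa using tendsto_pow_mul_exp_neg 0 hy
      have h4 : Tendsto (fun t : ℝ => (t ^ (m + 1))⁻¹) atTop (𝓝 0) :=
        (tendsto_pow_atTop (by simp)).inv_tendsto_atTop
      simpa [div_eq_mul_inv] using (h3.mul h4).neg
  rw [integral_add (hI1.const_mul y) (hI2.const_mul _), integral_const_mul,
    integral_const_mul] at key
  simp only [mul_one, one_pow, div_one, sub_neg_eq_add, zero_add] at key
  simp only [expIntegral]
  linarith

lemma integrableOn_gammaDensity_div (m : ℕ) {l β : ℝ} (hl : 0 < l) (hβ : 0 < β) :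
    IntegrableOn (fun x => x ^ m * Real.exp (-(l * x)) / (β + x)) (Ioi 0) := by
  refine Integrable.mono' ((integrableOn_pow_mul_exp_neg m hl).const_mul β⁻¹)
    (by fun_prop : Measurable _).aestronglyMeasurable ?_
  refine (ae_restrict_iff' measurableSet_Ioi).2 (ae_of_all _ fun t (ht : 0 < t) => ?_)
  rw [Real.norm_of_nonneg (by positivity), div_eq_inv_mul]
  gcongr
  linarith

/-- `e^{β l} E_{m+1}(β l) = ∫_0^∞ (l x)^m e^{-l x} / (m! (β + x)) dx`. -/
lemma exp_mul_expIntegral (m : ℕ) {l β : ℝ} (hl : 0 < l) (hβ : 0 < β) :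
    Real.exp (β * l) * expIntegral (m + 1) (β * l) =
      l ^ m / m.factorial * ∫ x in Ioi (0 : ℝ), x ^ m * Real.exp (-(l * x)) / (β + x) := by
  induction m with
  | zero =>
    have h := integral_Ioi_comp_one_add_div
      (fun u => Real.exp (-(β * l) * u) / u ^ 1) hβ
    rw [expIntegral, zero_add, ← mul_right_inj' hβ.ne', mul_left_comm, ← smul_eq_mul (a := β)
      (b := integral _ _), ← h, ← integral_const_mul]
    simp only [pow_zero, Nat.factorial_zero, Nat.cast_one, div_one, one_mul, pow_one]
    rw [← integral_const_mul]
    refine setIntegral_congr_fun measurableSet_Ioi fun x (hx : 0 < x) => ?_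
    have : Real.exp (-(β * l) * (1 + x / β)) = Real.exp (-(β * l)) * Real.exp (-(l * x)) := by
      rw [← Real.exp_add]
      congr 1
      field_simp
      ring
    rw [this, ← mul_div_assoc, ← mul_assoc, ← Real.exp_add]
    simp
    field_simp
  | succ m ih =>
    have hy : 0 < β * l := mul_pos hβ hl
    have h1 := expIntegral_succ m hy
    -- Writing x^{m+1}/(β + x) = x^m - β x^m/(β + x) gives this side the same recursion as the
    -- exponential integrals.
    have h2 : ∫ x in Ioi (0 : ℝ), x ^ (m + 1) * Real.exp (-(l * x)) / (β + x) =
        m.factorial / l ^ (m + 1) -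
          β * ∫ x in Ioi (0 : ℝ), x ^ m * Real.exp (-(l * x)) / (β + x) := by
      rw [← integral_pow_mul_exp_neg m hl, ← integral_const_mul,
        ← integral_sub (integrableOn_pow_mul_exp_neg m hl)
          ((integrableOn_gammaDensity_div m hl hβ).const_mul β)]
      refine setIntegral_congr_fun measurableSet_Ioi fun x (hx : 0 < x) => ?_
      have : β + x ≠ 0 := by positivity
      field_simp
      ring
    have hf : (m.factorial : ℝ) ≠ 0 := by positivity
    have h3 : Real.exp (β * l) * Real.exp (-(β * l)) = 1 := by
      rw [← Real.exp_add]; simp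
    have hm : (m + 1 : ℝ) ≠ 0 := by positivity
    have h4 : Real.exp (β * l) * expIntegral (m + 2) (β * l) =
        (1 - β * l * (Real.exp (β * l) * expIntegral (m + 1) (β * l))) / (m + 1) := by
      rw [eq_div_iff hm]
      linear_combination Real.exp (β * l) * h1 + h3
    rw [show m + 1 + 1 = m + 2 from rfl, h4, ih, h2, Nat.factorial_succ]
    push_cast
    field_simp
    ring

/-! The first moment of the logarithm under a Gamma law -/

lemma log_one_add_div_nonneg {β x : ℝ} (hβ : 0 < β) (hx : 0 ≤ x) : 0 ≤ Real.log (1 + x / β) :=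
  Real.log_nonneg (by have : 0 ≤ x / β := by positivity
                      linarith)

lemma log_one_add_div_le {β x : ℝ} (hβ : 0 < β) (hx : 0 ≤ x) : Real.log (1 + x / β) ≤ x / β := by
  have h : 0 ≤ x / β := by positivity
  have := Real.log_le_sub_one_of_pos (x := 1 + x / β) (by linarith)
  linarith

lemma integrableOn_log_mul (m : ℕ) {l β : ℝ} (hl : 0 < l) (hβ : 0 < β) (k : ℕ) :
    IntegrableOn (fun x => x ^ m * Real.exp (-(l * x)) * Real.log (1 + x / β) ^ k) (Ioi 0) := by
  refine Integrable.mono' ((integrableOn_pow_mul_exp_neg (m + k) hl).const_mul ((β ^ k)⁻¹))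
    (by fun_prop) ?_
  refine (ae_restrict_iff' measurableSet_Ioi).2 (ae_of_all _ fun t (ht : 0 < t) => ?_)
  have h0 := log_one_add_div_nonneg hβ ht.le
  rw [Real.norm_of_nonneg (by positivity)]
  calc _ ≤ t ^ m * Real.exp (-(l * t)) * (t / β) ^ k := by
        gcongr
        exact log_one_add_div_le hβ ht.le
    _ = _ := by rw [div_pow]; field_simp; ring

/-- The integrand is the derivative of log(1 + x/β) l^m x^m e^{-lx}/m!, which vanishes at infinity,
and at 0 because log 1 = 0. For m = 0 the truncated exponent m - 1 is harmless, its term carrying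
the factor m. -/
lemma integral_log_gammaDensity_succ (m : ℕ) {l β : ℝ} (hl : 0 < l) (hβ : 0 < β) :
    ∫ x in Ioi (0 : ℝ), (l ^ m / m.factorial * (x ^ m * Real.exp (-(l * x)) / (β + x)) +
      (m * l ^ m / m.factorial * (x ^ (m - 1) * Real.exp (-(l * x)) * Real.log (1 + x / β) ^ 1) -
      l ^ (m + 1) / m.factorial * (x ^ m * Real.exp (-(l * x)) * Real.log (1 + x / β) ^ 1))) =
      0 := by
  have hI := ((integrableOn_gammaDensity_div m hl hβ).const_mul (l ^ m / m.factorial)).add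
    (((integrableOn_log_mul (m - 1) hl hβ 1).const_mul (m * l ^ m / m.factorial)).sub
    ((integrableOn_log_mul m hl hβ 1).const_mul (l ^ (m + 1) / m.factorial)))
  have h0 : (0 : ℝ) = 0 - Real.log (1 + 0 / β) *
      (l ^ m / m.factorial * (0 ^ m * Real.exp (-(l * 0)))) := by simp
  conv_rhs => rw [h0]
  refine integral_Ioi_of_hasDerivAt_of_tendsto' (f := fun x => Real.log (1 + x / β) *
      (l ^ m / m.factorial * (x ^ m * Real.exp (-(l * x))))) (fun x (hx : 0 ≤ x) => ?_) hI ?_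
  · have hp : 0 < 1 + x / β := by positivity
    have h1 : HasDerivAt (fun x => Real.log (1 + x / β)) (1 / β / (1 + x / β)) x :=
      (((hasDerivAt_id x).div_const β).const_add 1).log hp.ne'
    have h2 : HasDerivAt (fun x => Real.exp (-(l * x))) (Real.exp (-(l * x)) * -l) x := by
      simpa using (((hasDerivAt_id x).const_mul l).neg).exp
    refine (h1.mul (((hasDerivAt_pow m x).mul h2).const_mul _)).congr_deriv ?_
    have : β + x ≠ 0 := by positivity
    simp only [pow_one, Pi.mul_apply]
    field_simp
    ring
  · have h1 := (tendsto_pow_mul_exp_neg (m + 1) hl).const_mul (β⁻¹ * (l ^ m / m.factorial))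
    rw [mul_zero] at h1
    refine tendsto_of_tendsto_of_tendsto_of_le_of_le' tendsto_const_nhds h1 ?_ ?_
    · filter_upwards [eventually_ge_atTop 0] with x hx
      have := log_one_add_div_nonneg hβ hx
      positivity
    · filter_upwards [eventually_ge_atTop 0] with x hx
      calc _ ≤ x / β * (l ^ m / m.factorial * (x ^ m * Real.exp (-(l * x)))) := by
            gcongr
            exact log_one_add_div_le hβ hx
        _ = _ := by field_simp; ring

/-- By the preceding identity, raising the index from m - 1 to m adds e^{βl} E_{m+1}(βl) to the
mean, so the means telescope. -/
theorem integral_log_gammaDensity (m : ℕ) {l β : ℝ} (hl : 0 < l) (hβ : 0 < β) :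
    ∫ x in Ioi (0 : ℝ), gammaDensity m l x * Real.log (1 + x / β) =
      Real.exp (β * l) * ∑ h ∈ Finset.Icc 1 (m + 1), expIntegral h (β * l) := by
  have hstep : ∀ m : ℕ, Real.exp (β * l) * expIntegral (m + 1) (β * l) +
      (m * l ^ m / m.factorial *
        ∫ x in Ioi (0 : ℝ), x ^ (m - 1) * Real.exp (-(l * x)) * Real.log (1 + x / β) ^ 1) =
      ∫ x in Ioi (0 : ℝ), gammaDensity m l x * Real.log (1 + x / β) := by
    intro m
    have h := integral_log_gammaDensity_succ m hl hβ
    have i1 := (integrableOn_gammaDensity_div m hl hβ).const_mul (l ^ m / m.factorial)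
    have i2 := (integrableOn_log_mul (m - 1) hl hβ 1).const_mul (m * l ^ m / m.factorial)
    have i3 := (integrableOn_log_mul m hl hβ 1).const_mul (l ^ (m + 1) / m.factorial)
    rw [integral_add i1 (by exact i2.sub i3), integral_sub i2 i3, integral_const_mul, integral_const_mul,
      integral_const_mul, ← exp_mul_expIntegral m hl hβ] at h
    have h5 : ∫ x in Ioi (0 : ℝ), gammaDensity m l x * Real.log (1 + x / β) =
        l ^ (m + 1) / m.factorial *
          ∫ x in Ioi (0 : ℝ), x ^ m * Real.exp (-(l * x)) * Real.log (1 + x / β) ^ 1 := by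
      rw [← integral_const_mul]
      congr 1
      ext x
      rw [gammaDensity, pow_one, mul_assoc]
    rw [h5]
    linarith
  induction m with
  | zero => simp [← hstep]
  | succ m ih =>
    rw [Finset.sum_Icc_succ_top (by omega), mul_add, ← ih, ← hstep (m + 1), add_comm]
    congr 1
    rw [← integral_const_mul]
    congr 1
    ext x
    rw [gammaDensity, Nat.factorial_succ]
    push_cast
    have : (m.factorial : ℝ) ≠ 0 := by positivity
    simp only [pow_one]
    field_simp

theorem integral_log_gammaMeasure (m : ℕ) {l β : ℝ} (hl : 0 < l) (hβ : 0 < β) :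
    ∫ x, Real.log (1 + x / β) ∂gammaMeasure (m + 1 : ℕ) l =
      Real.exp (β * l) * ∑ h ∈ Finset.Icc 1 (m + 1), expIntegral h (β * l) := by
  rw [integral_gammaMeasure _ _ hl, ← integral_log_gammaDensity m hl hβ]
  rfl

/-! ### The second moment of the logarithm: Mellin transforms and Meijer functions -/

lemma tendsto_log_pow_mul_rpow_neg (k : ℕ) {a : ℝ} (ha : 0 < a) :
    Tendsto (fun u : ℝ => Real.log u ^ k * u ^ (-a)) atTop (𝓝 0) := by
  have h := (isLittleO_log_rpow_rpow_atTop (k : ℝ) ha).tendsto_div_nhds_zero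
  refine h.congr' ?_
  filter_upwards [eventually_gt_atTop 0] with u hu
  rw [Real.rpow_natCast, Real.rpow_neg hu.le, div_eq_mul_inv]

/-- The bound log u ≤ (4/a) u^{a/4}, once squared, costs only half of the decay exponent a. -/
lemma integrableOn_log_sq_mul_rpow {a : ℝ} (ha : 0 < a) :
    IntegrableOn (fun u : ℝ => Real.log u ^ 2 * u ^ (-a - 1)) (Ioi 1) := by
  have h := (integrableOn_Ioi_rpow_of_lt (a := -(a / 2) - 1) (by linarith) one_pos).const_mul
    ((4 / a) ^ 2)
  refine Integrable.mono' h (by fun_prop : Measurable _).aestronglyMeasurable ?_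
  refine (ae_restrict_iff' measurableSet_Ioi).2 (ae_of_all _ fun u (hu : 1 < u) => ?_)
  have hu0 : 0 < u := by linarith
  have h0 := Real.log_nonneg hu.le
  rw [Real.norm_of_nonneg (by positivity)]
  calc _ ≤ (u ^ (a / 4) / (a / 4)) ^ 2 * u ^ (-a - 1) := by
        gcongr
        exact Real.log_le_rpow_div hu0.le (by positivity)
    _ = (4 / a) ^ 2 * ((u ^ (a / 4)) ^ 2 * u ^ (-a - 1)) := by field_simp
    _ = _ := by
        rw [← Real.rpow_natCast (u ^ (a / 4)), ← Real.rpow_mul hu0.le, ← Real.rpow_add hu0]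
        congr 2
        push_cast
        ring

lemma norm_log_sq_mul_cpow (s : ℂ) {u : ℝ} (hu : 1 < u) :
    ‖(Real.log u : ℂ) ^ 2 * (u : ℂ) ^ (-s - 1)‖ = Real.log u ^ 2 * u ^ (-s.re - 1) := by
  rw [norm_mul, norm_pow, Complex.norm_real, Complex.norm_cpow_eq_rpow_re_of_pos (by linarith),
    Real.norm_of_nonneg (Real.log_nonneg hu.le)]
  simp

lemma integrableOn_log_sq_mul_cpow {s : ℂ} (hs : 0 < s.re) :
    IntegrableOn (fun u : ℝ => (Real.log u : ℂ) ^ 2 * (u : ℂ) ^ (-s - 1)) (Ioi 1) := by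
  refine Integrable.mono' (integrableOn_log_sq_mul_rpow hs)
    (by fun_prop : Measurable _).aestronglyMeasurable ?_
  refine (ae_restrict_iff' measurableSet_Ioi).2 (ae_of_all _ fun u (hu : 1 < u) => ?_)
  rw [norm_log_sq_mul_cpow s hu]

lemma integral_log_sq_mul_cpow {s : ℂ} (hs : 0 < s.re) :
    ∫ u in Ioi (1 : ℝ), (Real.log u : ℂ) ^ 2 * (u : ℂ) ^ (-s - 1) = 2 / s ^ 3 := by
  have hs0 : s ≠ 0 := fun h => by simp [h] at hs
  -- A primitive of the integrand, found by integrating by parts twice; it vanishes at infinity, so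
  -- only the value at 1 contributes.
  let f : ℝ → ℂ := fun u => (u : ℂ) ^ (-s - 1 + 1) / (-s - 1 + 1) *
    ((Real.log u : ℂ) ^ 2 + 2 * (Real.log u : ℂ) / s + 2 / s ^ 2)
  have hf1 : f 1 = -(2 / s ^ 3) := by
    simp only [f]
    simp
    field_simp
  have key : ∫ u in Ioi (1 : ℝ), (Real.log u : ℂ) ^ 2 * (u : ℂ) ^ (-s - 1) = 0 - f 1 := by
    refine integral_Ioi_of_hasDerivAt_of_tendsto' (fun u (hu : 1 ≤ u) => ?_)
      (integrableOn_log_sq_mul_cpow hs) ?_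
    · have hu0 : (0 : ℝ) < u := by linarith
      have huc : (u : ℂ) ≠ 0 := by exact_mod_cast hu0.ne'
      have h1 := hasDerivAt_ofReal_cpow_const' (x := u) (r := -s - 1) hu0.ne'
        (by intro h; apply hs0; linear_combination -h)
      have h2 : HasDerivAt (fun u : ℝ => (Real.log u : ℂ)) ((u⁻¹ : ℝ) : ℂ) u :=
        (Real.hasDerivAt_log hu0.ne').ofReal_comp
      have h3 := ((h2.pow 2).add ((h2.const_mul 2).div_const s)).add_const (2 / s ^ 2)
      refine (h1.mul h3).congr_deriv ?_
      have h4 : (u : ℂ) ^ (-s - 1 + 1) = (u : ℂ) ^ (-s - 1) * u := by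
        rw [Complex.cpow_add _ _ huc, Complex.cpow_one]
      simp only [Pi.add_apply, Pi.pow_apply, h4, Complex.ofReal_inv]
      have : -s - 1 + 1 ≠ 0 := by simpa using hs0
      rw [show -s - 1 + 1 = -s by ring]
      field_simp
      ring
    · have h0 := tendsto_log_pow_mul_rpow_neg 0 hs
      have h1 := tendsto_log_pow_mul_rpow_neg 1 hs
      have h2 := tendsto_log_pow_mul_rpow_neg 2 hs
      have h := ((h2.add ((h1.const_mul (2 / ‖s‖)))).add (h0.const_mul (2 / ‖s‖ ^ 2))).const_mul
        (1 / ‖s‖)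
      simp only [mul_zero, add_zero] at h
      refine squeeze_zero_norm' ?_ h
      filter_upwards [eventually_gt_atTop 1] with u hu
      have hu0 : (0 : ℝ) < u := by linarith
      have hl := Real.log_nonneg hu.le
      simp only [f]
      rw [norm_mul, norm_div, Complex.norm_cpow_eq_rpow_re_of_pos hu0,
        show -s - 1 + 1 = -s by ring, norm_neg, Complex.neg_re]
      have h5 : ‖(Real.log u : ℂ) ^ 2 + 2 * (Real.log u : ℂ) / s + 2 / s ^ 2‖ ≤
          Real.log u ^ 2 + 2 * Real.log u / ‖s‖ + 2 / ‖s‖ ^ 2 := by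
        refine (norm_add₃_le).trans (le_of_eq ?_)
        rw [norm_pow, norm_div, norm_div, norm_mul, norm_pow, Complex.norm_real,
          Real.norm_of_nonneg hl]
        simp
      calc _ ≤ u ^ (-s.re) / ‖s‖ * (Real.log u ^ 2 + 2 * Real.log u / ‖s‖ + 2 / ‖s‖ ^ 2) := by
            gcongr
        _ = _ := by ring
  rw [key, hf1]
  ring

/-- The real integral `∫_1^∞ (log u)² u^t e^{-x u} du`. -/
noncomputable def logSqLaplace (t : ℕ) (x : ℝ) : ℝ :=
  ∫ u in Ioi (1 : ℝ), Real.log u ^ 2 * u ^ t * Real.exp (-(x * u))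

lemma log_sq_mul_pow_mul_exp_le (t : ℕ) {x u : ℝ} (hu : 1 ≤ u) :
    Real.log u ^ 2 * u ^ t * Real.exp (-(x * u)) ≤ u ^ (t + 2) * Real.exp (-(x * u)) := by
  have h1 : Real.log u ≤ u := (Real.log_le_sub_one_of_pos (by linarith)).trans (by linarith)
  have h0 := Real.log_nonneg hu
  rw [show u ^ (t + 2) = u ^ 2 * u ^ t by ring]
  gcongr

lemma integrableOn_logSqLaplace (t : ℕ) {x : ℝ} (hx : 0 < x) :
    IntegrableOn (fun u : ℝ => Real.log u ^ 2 * u ^ t * Real.exp (-(x * u))) (Ioi 1) := by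
  refine Integrable.mono' ((integrableOn_pow_mul_exp_neg (t + 2) hx).mono_set
    (Ioi_subset_Ioi zero_le_one)) (by fun_prop : Measurable _).aestronglyMeasurable ?_
  refine (ae_restrict_iff' measurableSet_Ioi).2 (ae_of_all _ fun u (hu : 1 < u) => ?_)
  have hu0 : 0 < u := by linarith
  rw [Real.norm_of_nonneg (by positivity)]
  exact log_sq_mul_pow_mul_exp_le t hu.le

/-- Pointwise Mellin inversion needs continuity at the point. The exponential with rate x/2
dominates all rates near x. -/
lemma continuousAt_logSqLaplace (t : ℕ) {x : ℝ} (hx : 0 < x) :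
    ContinuousAt (logSqLaplace t) x := by
  refine continuousAt_of_dominated (bound := fun u => u ^ (t + 2) * Real.exp (-(x / 2 * u)))
    (Eventually.of_forall fun y => (by fun_prop : Measurable _).aestronglyMeasurable) ?_
    ((integrableOn_pow_mul_exp_neg (t + 2) (half_pos hx)).mono_set (Ioi_subset_Ioi zero_le_one)) ?_
  · filter_upwards [lt_mem_nhds (half_lt_self hx)] with y hy
    refine (ae_restrict_iff' measurableSet_Ioi).2 (ae_of_all _ fun u (hu : 1 < u) => ?_)
    have hu0 : 0 < u := by linarith
    rw [Real.norm_of_nonneg (by positivity)]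
    refine (log_sq_mul_pow_mul_exp_le t hu.le).trans ?_
    gcongr
  · exact ae_of_all _ fun u => by fun_prop

/-- The integrand of the double integral that gives the Mellin transform of `logSqLaplace`. -/
noncomputable def mellinKernel (t : ℕ) (w : ℂ) (x u : ℝ) : ℂ :=
  (x : ℂ) ^ (w - 1) * ((Real.log u ^ 2 * u ^ t * Real.exp (-(x * u)) : ℝ) : ℂ)

lemma norm_mellinKernel (t : ℕ) (w : ℂ) {x u : ℝ} (hx : 0 < x) (hu : 1 < u) :
    ‖mellinKernel t w x u‖ =
      Real.log u ^ 2 * u ^ t * (x ^ (w.re - 1) * Real.exp (-(u * x))) := by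
  have hu0 : 0 < u := by linarith
  rw [mellinKernel, norm_mul, Complex.norm_cpow_eq_rpow_re_of_pos hx, Complex.norm_real,
    Real.norm_of_nonneg (by positivity), mul_comm x u]
  simp
  ring

lemma measurable_mellinKernel (t : ℕ) (w : ℂ) :
    Measurable (Function.uncurry (mellinKernel t w)) := by
  unfold mellinKernel Function.uncurry
  fun_prop

lemma integrableOn_rpow_mul_exp {a u : ℝ} (ha : 0 < a) (hu : 0 < u) :
    IntegrableOn (fun x : ℝ => x ^ (a - 1) * Real.exp (-(u * x))) (Ioi 0) := by
  refine (integrableOn_rpow_mul_exp_neg_mul_rpow (p := 1) (s := a - 1) (b := u)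
    (by linarith) one_pos hu).congr_fun (fun x _ => ?_) measurableSet_Ioi
  simp

/-- Justifies Fubini for the Mellin transform. Integrating the norm in x first leaves Γ(Re w) (log
u)² u^{t - Re w}, integrable on u > 1 because Re w > t + 1. -/
lemma integrable_mellinKernel (t : ℕ) {w : ℂ} (hw : t + 1 < w.re) :
    Integrable (Function.uncurry (mellinKernel t w))
      ((volume.restrict (Ioi 0)).prod (volume.restrict (Ioi 1))) := by
  have hw0 : 0 < w.re := by
    have : (0 : ℝ) ≤ t := by positivity
    linarith
  rw [integrable_prod_iff' (measurable_mellinKernel t w).aestronglyMeasurable]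
  constructor
  · refine (ae_restrict_iff' measurableSet_Ioi).2 (ae_of_all _ fun u (hu : 1 < u) => ?_)
    refine Integrable.mono' ((integrableOn_rpow_mul_exp hw0 (by linarith : 0 < u)).const_mul
      (Real.log u ^ 2 * u ^ t))
      ((measurable_mellinKernel t w).comp measurable_prodMk_right).aestronglyMeasurable ?_
    refine (ae_restrict_iff' measurableSet_Ioi).2 (ae_of_all _ fun x (hx : 0 < x) => ?_)
    exact (norm_mellinKernel t w hx hu).le
  · have h := (integrableOn_log_sq_mul_rpow (a := w.re - t - 1) (by linarith)).const_mul
      (Real.Gamma w.re)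
    refine IntegrableOn.congr_fun h (fun u (hu : 1 < u) => ?_) measurableSet_Ioi
    have hu0 : 0 < u := by linarith
    have h2 : ∫ x in Ioi (0 : ℝ), ‖Function.uncurry (mellinKernel t w) (x, u)‖ =
        ∫ x in Ioi (0 : ℝ), Real.log u ^ 2 * u ^ t * (x ^ (w.re - 1) * Real.exp (-(u * x))) :=
      setIntegral_congr_fun measurableSet_Ioi fun x (hx : 0 < x) => norm_mellinKernel t w hx hu
    rw [h2, integral_const_mul, Real.integral_rpow_mul_exp_neg_mul_Ioi hw0 hu0,
      one_div, Real.inv_rpow hu0.le, ← Real.rpow_neg hu0.le,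
      show -(w.re - t - 1) - 1 = (t : ℝ) + -w.re by ring, Real.rpow_add hu0, Real.rpow_natCast]
    ring

lemma mellinKernel_integral_right (t : ℕ) (w : ℂ) (x : ℝ) :
    ∫ u in Ioi (1 : ℝ), mellinKernel t w x u = (x : ℂ) ^ (w - 1) • (logSqLaplace t x : ℂ) := by
  simp only [mellinKernel]
  rw [integral_const_mul, integral_complex_ofReal]
  rfl

lemma mellinConvergent_logSqLaplace (t : ℕ) {w : ℂ} (hw : t + 1 < w.re) :
    MellinConvergent (fun x => (logSqLaplace t x : ℂ)) w := by
  have h := (integrable_mellinKernel t hw).integral_prod_left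
  refine h.congr (ae_of_all _ fun x => ?_)
  exact mellinKernel_integral_right t w x

/-- After exchanging integrals, the x-integral is Γ(w) u^{-w}, and what remains is
`integral_log_sq_mul_cpow` at s = w - t - 1. -/
lemma mellin_logSqLaplace (t : ℕ) {w : ℂ} (hw : t + 1 < w.re) :
    mellin (fun x => (logSqLaplace t x : ℂ)) w = Complex.Gamma w * (2 / (w - t - 1) ^ 3) := by
  have hw0 : 0 < w.re := by
    have : (0 : ℝ) ≤ t := by positivity
    linarith
  have h1 : mellin (fun x => (logSqLaplace t x : ℂ)) w =
      ∫ x in Ioi (0 : ℝ), ∫ u in Ioi (1 : ℝ), mellinKernel t w x u := by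
    simp only [mellinKernel_integral_right]
    rfl
  rw [h1, integral_integral_swap (integrable_mellinKernel t hw),
    ← integral_log_sq_mul_cpow (s := w - t - 1) (by simpa using by linarith),
    ← integral_const_mul]
  refine setIntegral_congr_fun measurableSet_Ioi fun u (hu : 1 < u) => ?_
  have hu0 : 0 < u := by linarith
  have huc : (u : ℂ) ≠ 0 := by exact_mod_cast hu0.ne'
  have h2 : ∀ x : ℝ, mellinKernel t w x u = (Real.log u : ℂ) ^ 2 * (u : ℂ) ^ t *
      ((x : ℂ) ^ (w - 1) * Complex.exp (-(u * x))) := by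
    intro x
    rw [mellinKernel]
    push_cast
    rw [mul_comm (x : ℂ) u]
    ring
  simp only [h2]
  rw [integral_const_mul, Complex.integral_cpow_mul_exp_neg_mul_Ioi hw0 hu0,
    show -(w - t - 1) - 1 = (t : ℂ) + -w by ring, Complex.cpow_add _ _ huc, Complex.cpow_natCast,
    Complex.cpow_neg, one_div, Complex.inv_cpow]
  · ring
  · rw [Complex.arg_ofReal_of_nonneg hu0.le]
    exact Real.pi_pos.ne

lemma norm_Gamma_le {w : ℂ} (hw : 0 < w.re) : ‖Complex.Gamma w‖ ≤ Real.Gamma w.re := by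
  rw [Complex.Gamma_eq_integral hw, Real.Gamma_eq_integral hw, Complex.GammaIntegral]
  refine (norm_integral_le_integral_norm _).trans (le_of_eq ?_)
  refine setIntegral_congr_fun measurableSet_Ioi fun x (hx : 0 < x) => ?_
  rw [norm_mul, Complex.norm_cpow_eq_rpow_re_of_pos hx, Complex.norm_real,
    Real.norm_of_nonneg (Real.exp_pos _).le]
  simp

lemma continuousAt_Gamma_of_re_pos {w : ℂ} (hw : 0 < w.re) : ContinuousAt Complex.Gamma w := by
  refine (Complex.differentiableAt_Gamma w fun m h => ?_).continuousAt
  rw [h] at hw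
  simp at hw
  have : (0 : ℝ) ≤ m := by positivity
  linarith

/-- No decay of Γ is needed: |Γ(c + iy)| ≤ Γ(c) on the line, and the cube in the denominator already
makes the integrand O(1/(1 + y²)). -/
lemma verticalIntegrable_mellin_logSqLaplace (t : ℕ) {c : ℝ} (hc : t + 1 < c) :
    Complex.VerticalIntegrable (mellin fun x => (logSqLaplace t x : ℂ)) c := by
  have hc0 : 0 < c := by
    have : (0 : ℝ) ≤ t := by positivity
    linarith
  have hre : ∀ y : ℝ, ((c : ℂ) + y * Complex.I).re = c := fun y => by simp
  have h1 : ∀ y : ℝ, mellin (fun x => (logSqLaplace t x : ℂ)) (c + y * Complex.I) =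
      Complex.Gamma (c + y * Complex.I) * (2 / ((c + y * Complex.I) - t - 1) ^ 3) :=
    fun y => mellin_logSqLaplace t (by rw [hre]; exact hc)
  unfold Complex.VerticalIntegrable
  simp only [h1]
  set a : ℝ := c - t - 1 with ha
  have ha0 : 0 < a := by linarith
  have hn : ∀ y : ℝ, ((c : ℂ) + y * Complex.I) - t - 1 = a + y * Complex.I := fun y => by
    rw [ha]; push_cast; ring
  have hne : ∀ y : ℝ, (a : ℂ) + y * Complex.I ≠ 0 := fun y h => by
    have := congrArg Complex.re h
    simp at this
    linarith
  -- Chosen so that m(1 + y²) ≤ a² + y² for every y.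
  set m : ℝ := min (a ^ 2) 1 with hm
  have hm0 : 0 < m := by positivity
  refine Integrable.mono' (integrable_inv_one_add_sq.const_mul (Real.Gamma c * (2 / (a * m)))) ?_ ?_
  · refine Continuous.aestronglyMeasurable ?_
    refine Continuous.mul ?_ ?_
    · rw [continuous_iff_continuousAt]
      intro y
      exact (continuousAt_Gamma_of_re_pos (by rw [hre]; exact hc0)).comp
        (f := fun y : ℝ => (c : ℂ) + y * Complex.I) (by fun_prop)
    · simp only [hn]
      exact continuous_const.div (by fun_prop) fun y => pow_ne_zero _ (hne y)
  · refine ae_of_all _ fun y => ?_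
    rw [norm_mul, hn, norm_div, norm_pow, mul_assoc]
    have h2 := norm_Gamma_le (w := (c : ℂ) + y * Complex.I) (by rw [hre]; exact hc0)
    rw [hre] at h2
    have h3 : ‖(a : ℂ) + y * Complex.I‖ ^ 2 = a ^ 2 + y ^ 2 := by
      rw [← Complex.normSq_eq_norm_sq, Complex.normSq_add_mul_I]
    have h4 : a ≤ ‖(a : ℂ) + y * Complex.I‖ := by
      refine le_trans (le_of_eq ?_) (Complex.re_le_norm _)
      simp
    have h5 : m * (1 + y ^ 2) ≤ a ^ 2 + y ^ 2 := by
      have h6 : m ≤ a ^ 2 := min_le_left _ _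
      have h7 : m ≤ 1 := min_le_right _ _
      nlinarith [sq_nonneg y]
    have h8 : a * (m * (1 + y ^ 2)) ≤ ‖(a : ℂ) + y * Complex.I‖ ^ 3 := by
      rw [pow_succ' ‖(a : ℂ) + y * Complex.I‖ 2, h3]
      gcongr
    have hG : 0 < Real.Gamma c := Real.Gamma_pos_of_pos hc0
    calc _ ≤ Real.Gamma c * (2 / (a * (m * (1 + y ^ 2)))) := by
          simp only [Complex.norm_ofNat]
          gcongr
      _ = _ := by field_simp

/-- The Meijer functions of the second moment are Laplace transforms of `(log u)² u^t`. -/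
theorem meijerG_eq_logSqLaplace (t : ℕ) {β : ℝ} (hβ : 0 < β) :
    meijerG 4 0 ![-(t : ℂ), -(t : ℂ), -(t : ℂ)]
      ![0, -(t : ℂ) - 1, -(t : ℂ) - 1, -(t : ℂ) - 1] (β : ℂ) = (logSqLaplace t β : ℂ) / 2 := by
  have ht0 : (0 : ℝ) ≤ t := by positivity
  have hex : ∃ c : ℝ, MeijerSeparates 4 0 ![-(t : ℂ), -(t : ℂ), -(t : ℂ)]
      ![0, -(t : ℂ) - 1, -(t : ℂ) - 1, -(t : ℂ) - 1] c := by
    refine ⟨-t - 2, fun j _ => ?_, fun j hj => by omega⟩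
    fin_cases j <;> (simp; try linarith)
  rw [meijerG, dif_pos hex]
  have hspec := hex.choose_spec
  set c := hex.choose
  -- The chosen contour is only known to separate the poles. Lying left of the parameter -t - 1 puts
  -- -c in the half-plane where the Mellin transform is known.
  have hc : (t : ℝ) + 1 < -c := by
    have := hspec.1 1 (by decide)
    simp at this
    linarith
  have hc0 : c < 0 := by linarith
  -- Here w = -s. Each quotient Γ(-t-1-s)/Γ(-t-s) equals 1/(-t-1-s) = 1/(w-t-1), so the Gamma
  -- factors reduce to Γ(w)/(w-t-1)³.
  have hint : ∀ y : ℝ, meijerIntegrand 4 0 ![-(t : ℂ), -(t : ℂ), -(t : ℂ)]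
      ![0, -(t : ℂ) - 1, -(t : ℂ) - 1, -(t : ℂ) - 1] (β : ℂ) (c + y * Complex.I) =
      (1 / 2) * ((β : ℂ) ^ (-(((-c : ℝ) : ℂ) + (-y : ℝ) * Complex.I)) •
        mellin (fun x => (logSqLaplace t x : ℂ)) (((-c : ℝ) : ℂ) + (-y : ℝ) * Complex.I)) := by
    intro y
    rw [mellin_logSqLaplace t (by simpa using hc)]
    set s : ℂ := c + y * Complex.I with hs
    have hsre : s.re = c := by simp [hs]
    have hw : ((-c : ℝ) : ℂ) + (-y : ℝ) * Complex.I = -s := by rw [hs]; push_cast; ring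
    rw [hw]
    have hz : -(t : ℂ) - 1 - s ≠ 0 := fun h => by
      have := congrArg Complex.re h
      simp [hsre] at this
      linarith
    have hG : Complex.Gamma (-(t : ℂ) - s) =
        (-(t : ℂ) - 1 - s) * Complex.Gamma (-(t : ℂ) - 1 - s) := by
      rw [← Complex.Gamma_add_one _ hz]
      congr 1
      ring
    have hG0 : Complex.Gamma (-(t : ℂ) - 1 - s) ≠ 0 :=
      Complex.Gamma_ne_zero_of_re_pos (by simp [hsre]; linarith)
    simp only [meijerIntegrand, Finset.prod_filter, Fin.prod_univ_four, Fin.prod_univ_three]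
    simp
    rw [hG, show -s - (t : ℂ) - 1 = -(t : ℂ) - 1 - s by ring]
    field_simp
  simp only [hint]
  -- The substitution w = -s reverses the line; y ↦ -y restores the orientation used by `mellinInv`.
  rw [integral_const_mul, integral_neg_eq_self (μ := (volume : Measure ℝ)) (fun y : ℝ =>
    (β : ℂ) ^ (-(((-c : ℝ) : ℂ) + (y : ℝ) * Complex.I)) •
      mellin (fun x => (logSqLaplace t x : ℂ)) (((-c : ℝ) : ℂ) + (y : ℝ) * Complex.I))]
  have h := mellinInv_mellin_eq (-c) (fun x => (logSqLaplace t x : ℂ)) hβ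
    (mellinConvergent_logSqLaplace t (by simpa using hc))
    (verticalIntegrable_mellin_logSqLaplace t hc)
    (Complex.continuous_ofReal.continuousAt.comp (continuousAt_logSqLaplace t hβ))
  rw [mellinInv] at h
  rw [← h, Complex.real_smul]
  push_cast
  ring

/-- The second moment of the logarithm under the Gamma law of shape `n` and rate `1`. -/
theorem integral_log_sq_gammaMeasure {Nt m : ℕ} {γ : ℝ} (hNt : 0 < Nt) (hγ : 0 < γ) :
    ((Real.Gamma (m + 1 : ℕ) * ∫ x, Real.log (1 + x / (Nt / γ)) ^ 2
      ∂gammaMeasure (m + 1 : ℕ) 1 : ℝ) : ℂ) =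
      ((2 * Real.exp (Nt / γ) * (Nt / γ) ^ (m + 1) : ℝ) : ℂ) * meijerSum Nt (m + 1) γ := by
  set β : ℝ := Nt / γ with hβdef
  have hβ : 0 < β := by positivity
  have h1 : meijerSum Nt (m + 1) γ = ((∑ t ∈ Finset.range (m + 1),
      (m.choose t : ℝ) * (-1) ^ (m - t) * (logSqLaplace t β / 2) : ℝ) : ℂ) := by
    rw [meijerSum]
    push_cast
    refine Finset.sum_congr rfl fun t _ => ?_
    have := meijerG_eq_logSqLaplace t hβ
    rw [hβdef] at this
    push_cast at this
    rw [this]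
  -- The alternating binomial sum is the expansion of (u - 1)^m under the integral.
  have h2 : ∑ t ∈ Finset.range (m + 1), (m.choose t : ℝ) * (-1) ^ (m - t) *
      (logSqLaplace t β / 2) =
      1 / 2 * ∫ u in Ioi (1 : ℝ), Real.log u ^ 2 * (u - 1) ^ m * Real.exp (-(β * u)) := by
    have h3 : ∀ u : ℝ, Real.log u ^ 2 * (u - 1) ^ m * Real.exp (-(β * u)) =
        ∑ t ∈ Finset.range (m + 1), (m.choose t : ℝ) * (-1) ^ (m - t) *
          (Real.log u ^ 2 * u ^ t * Real.exp (-(β * u))) := by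
      intro u
      rw [sub_eq_add_neg, add_pow, Finset.mul_sum, Finset.sum_mul]
      exact Finset.sum_congr rfl fun t _ => by ring
    simp only [h3]
    rw [integral_finsetSum _ fun t _ => (integrableOn_logSqLaplace t hβ).const_mul _,
      Finset.mul_sum]
    refine Finset.sum_congr rfl fun t _ => ?_
    rw [integral_const_mul, logSqLaplace]
    ring
  have h4 := integral_Ioi_comp_one_add_div
    (fun u => Real.log u ^ 2 * (u - 1) ^ m * Real.exp (-(β * u))) hβ
  rw [h1, h2, ← Complex.ofReal_mul]
  clear_value β
  clear h1 h2
  congr 1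
  have h5 : Real.Gamma ((m + 1 : ℕ) : ℝ) = m.factorial := by
    push_cast
    exact Real.Gamma_nat_eq_factorial m
  have hf : (m.factorial : ℝ) ≠ 0 := by positivity
  rw [h5, integral_gammaMeasure _ _ one_pos, ← integral_const_mul]
  -- For u = 1 + x/β one has x^m = β^m (u-1)^m and e^{-x} = e^β e^{-βu}. The remaining factor β
  -- comes from dx = β du in `h4`.
  have h6 : ∫ x in Ioi (0 : ℝ), (m.factorial : ℝ) *
      (gammaDensity m 1 x • Real.log (1 + x / β) ^ 2) =
      Real.exp β * β ^ m * ∫ x in Ioi (0 : ℝ), Real.log (1 + x / β) ^ 2 * (1 + x / β - 1) ^ m *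
        Real.exp (-(β * (1 + x / β))) := by
    rw [← integral_const_mul]
    congr 1
    ext x
    have h7 : Real.exp (-(β * (1 + x / β))) = Real.exp (-β) * Real.exp (-x) := by
      rw [← Real.exp_add]
      congr 1
      field_simp
      ring
    have h8 : Real.exp β * Real.exp (-β) = 1 := by rw [← Real.exp_add]; simp
    rw [h7, gammaDensity, add_sub_cancel_left, div_pow, smul_eq_mul, one_pow, one_mul]
    field_simp
    linear_combination (-(x ^ m * Real.log ((β + x) / β) ^ 2)) * h8
  rw [h6, h4, smul_eq_mul]
  ring

/-! Integrals against the circularly symmetric complex Gaussian law -/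

instance : IsProbabilityMeasure stdComplexGaussian :=
  Measure.isProbabilityMeasure_map Complex.measurableEquivRealProd.symm.measurable.aemeasurable

lemma integral_stdComplexGaussian {E : Type*} [NormedAddCommGroup E] [NormedSpace ℝ E]
    (f : ℂ → E) : ∫ g, f g ∂stdComplexGaussian =
      ∫ p : ℝ × ℝ, f (p.1 + p.2 * Complex.I)
        ∂((gaussianReal 0 (1 / 2)).prod (gaussianReal 0 (1 / 2))) := by
  rw [stdComplexGaussian, integral_map_equiv]
  congr 1
  ext p
  congr 1
  apply Complex.ext <;> simp [Complex.measurableEquivRealProd]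

lemma integral_stdComplexGaussian_mul (f h : ℝ → ℂ) (F : ℂ → ℂ)
    (hF : ∀ x y : ℝ, F (x + y * Complex.I) = f x * h y) :
    ∫ g, F g ∂stdComplexGaussian =
      (∫ x, f x ∂gaussianReal 0 (1 / 2)) * ∫ y, h y ∂gaussianReal 0 (1 / 2) := by
  rw [integral_stdComplexGaussian, ← integral_prod_mul]
  simp only [hF]

lemma integral_cexp_re_mul (z : ℂ) :
    ∫ g, Complex.exp (((z * g).re : ℝ) * Complex.I) ∂stdComplexGaussian =
      Complex.exp (-((‖z‖ ^ 2 : ℝ) : ℂ) / 4) := by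
  rw [integral_stdComplexGaussian_mul (fun x => Complex.exp (z.re * x * Complex.I))
    (fun y => Complex.exp ((-z.im : ℝ) * y * Complex.I))]
  · have h : ∀ t : ℝ, ∫ x : ℝ, Complex.exp (t * x * Complex.I) ∂gaussianReal 0 (1 / 2) =
        Complex.exp (-(t : ℂ) ^ 2 / 4) := by
      intro t
      rw [← charFun_apply_real, charFun_gaussianReal]
      congr 1
      simp
      ring
    rw [h, h, ← Complex.exp_add, ← Complex.normSq_eq_norm_sq, Complex.normSq_apply]
    congr 1
    push_cast
    ring
  · intro x y
    rw [← Complex.exp_add]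
    congr 1
    simp
    ring

/-- Variance 1/2 makes the density π^{-1/2} e^{-x²}, so this is a complex Gaussian integral,
convergent because Re(s d²) < 1. -/
lemma integral_cexp_sq_gaussianReal {s : ℂ} {d : ℝ} (h : (s * d ^ 2).re < 1) (c : ℝ) :
    ∫ x : ℝ, Complex.exp (s * ((c + d * x : ℝ) : ℂ) ^ 2) ∂gaussianReal 0 (1 / 2) =
      ((Real.sqrt Real.pi)⁻¹ : ℝ) * (Real.pi / (1 - s * d ^ 2)) ^ (1 / 2 : ℂ) *
        Complex.exp (s * c ^ 2 / (1 - s * d ^ 2)) := by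
  have hne : 1 - s * d ^ 2 ≠ 0 := fun h0 => by
    rw [← sub_eq_zero.1 h0] at h
    simp at h
  rw [integral_gaussianReal_eq_integral_smul (by simp)]
  have h1 : ∀ x : ℝ, gaussianPDFReal 0 (1 / 2) x •
      Complex.exp (s * ((c + d * x : ℝ) : ℂ) ^ 2) = ((Real.sqrt Real.pi)⁻¹ : ℝ) *
        Complex.exp ((s * d ^ 2 - 1) * x ^ 2 + (2 * s * c * d) * x + s * c ^ 2) := by
    intro x
    have h2 : gaussianPDFReal 0 (1 / 2) x = (Real.sqrt Real.pi)⁻¹ * Real.exp (-x ^ 2) := by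
      have h3 : 2 * Real.pi * ((1 / 2 : NNReal) : ℝ) = Real.pi := by push_cast; ring
      have h4 : -(x - 0) ^ 2 / (2 * ((1 / 2 : NNReal) : ℝ)) = -x ^ 2 := by push_cast; ring
      rw [gaussianPDFReal, h3, h4]
    rw [h2, Complex.real_smul, Complex.ofReal_mul, Complex.ofReal_exp, mul_assoc,
      ← Complex.exp_add]
    congr 2
    push_cast
    ring
  simp only [h1]
  rw [integral_const_mul, integral_cexp_quadratic (by simpa using h), neg_sub, ← mul_assoc]
  congr 2
  have hne' : s * d ^ 2 - 1 ≠ 0 := fun h0 => hne (by linear_combination -h0)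
  field_simp
  ring

/-- The real and imaginary coordinates give two equal one-dimensional prefactors; their product is
the square of the principal root, so no branch choice remains. -/
lemma integral_cexp_norm_sq {s : ℂ} {d : ℝ} (h : (s * d ^ 2).re < 1) (c : ℂ) :
    ∫ g, Complex.exp (s * ((‖c + d * g‖ ^ 2 : ℝ) : ℂ)) ∂stdComplexGaussian =
      (1 - s * d ^ 2)⁻¹ * Complex.exp (s * ((‖c‖ ^ 2 : ℝ) : ℂ) / (1 - s * d ^ 2)) := by
  have hne : 1 - s * d ^ 2 ≠ 0 := fun h0 => by
    rw [← sub_eq_zero.1 h0] at h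
    simp at h
  rw [integral_stdComplexGaussian_mul
    (fun x => Complex.exp (s * ((c.re + d * x : ℝ) : ℂ) ^ 2))
    (fun x => Complex.exp (s * ((c.im + d * x : ℝ) : ℂ) ^ 2)),
    integral_cexp_sq_gaussianReal h, integral_cexp_sq_gaussianReal h]
  · have h1 : ((Real.pi / (1 - s * d ^ 2)) ^ (1 / 2 : ℂ)) ^ 2 = Real.pi / (1 - s * d ^ 2) := by
      rw [one_div]
      exact Complex.cpow_ofNat_inv_pow _ 2
    have h2 : (((Real.sqrt Real.pi)⁻¹ : ℝ) : ℂ) ^ 2 = (Real.pi : ℂ)⁻¹ := by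
      norm_cast
      rw [inv_pow, Real.sq_sqrt Real.pi_pos.le]
    have h3 : Complex.exp (s * ((‖c‖ ^ 2 : ℝ) : ℂ) / (1 - s * d ^ 2)) =
        Complex.exp (s * c.re ^ 2 / (1 - s * d ^ 2)) *
          Complex.exp (s * c.im ^ 2 / (1 - s * d ^ 2)) := by
      rw [← Complex.exp_add, ← Complex.normSq_eq_norm_sq, Complex.normSq_apply]
      congr 1
      push_cast
      ring
    have hpi : (Real.pi : ℂ) ≠ 0 := by exact_mod_cast Real.pi_pos.ne'
    rw [h3]
    calc _ = ((((Real.sqrt Real.pi)⁻¹ : ℝ) : ℂ) ^ 2 *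
          ((Real.pi / (1 - s * d ^ 2)) ^ (1 / 2 : ℂ)) ^ 2) *
          (Complex.exp (s * c.re ^ 2 / (1 - s * d ^ 2)) *
          Complex.exp (s * c.im ^ 2 / (1 - s * d ^ 2))) := by ring
      _ = _ := by
        rw [h1, h2]
        congr 1
        field_simp
  · intro x y
    rw [← Complex.exp_add, ← Complex.normSq_eq_norm_sq, Complex.normSq_apply]
    congr 1
    simp
    ring

/-- Solving for q = ibr/(1 - ibe) gives Re q = -b²re/(1 + b²e²) ≤ 0. The bound by 1 is the
convergence condition of `integral_cexp_norm_sq` for the outer integral. -/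
lemma re_lt_one_of_mul_eq {q : ℂ} {b r e : ℝ} (hr : 0 ≤ r) (he : 0 ≤ e)
    (h : q * (1 - Complex.I * b * e) = Complex.I * b * r) : q.re < 1 := by
  have h1 := congrArg Complex.re h
  have h2 := congrArg Complex.im h
  simp at h1 h2
  by_contra hq
  push Not at hq
  have h3 : q.re * (1 + b ^ 2 * e ^ 2) = -(b ^ 2 * r * e) := by
    linear_combination h1 - b * e * h2
  have h4 : 0 < q.re * (1 + b ^ 2 * e ^ 2) := by positivity
  have h5 : 0 ≤ b ^ 2 * r * e := by positivity
  linarith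

lemma one_sub_I_mul_ne_zero (x : ℝ) : 1 - Complex.I * (x : ℂ) ≠ 0 := fun h => by
  have := congrArg Complex.re h
  simp at this

/-- The characteristic function of the squared moduli of two correlated complex Gaussians. -/
lemma integral_cexp_norm_sq_pair (a b : ℝ) {c : ℂ} {d : ℝ} (hcd : ‖c‖ ^ 2 + d ^ 2 = 1) :
    ∫ g : ℂ × ℂ, Complex.exp (((a * ‖g.1‖ ^ 2 + b * ‖c * g.1 + d * g.2‖ ^ 2 : ℝ) : ℂ) * Complex.I)
      ∂(stdComplexGaussian.prod stdComplexGaussian) =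
      (1 - Complex.I * a - Complex.I * b - (1 - ‖c‖ ^ 2 : ℝ) * a * b)⁻¹ := by
  rw [integral_prod]
  swap
  · refine Integrable.of_bound (C := 1) (by fun_prop : Measurable _).aestronglyMeasurable
      (ae_of_all _ fun g => ?_)
    rw [Complex.norm_exp_ofReal_mul_I]
  have hne : 1 - Complex.I * (b : ℂ) * (d : ℂ) ^ 2 ≠ 0 := by
    have := one_sub_I_mul_ne_zero (b * d ^ 2)
    push_cast at this
    rwa [← mul_assoc] at this
  -- Integrating out the second Gaussian leaves the exponent q‖x‖² in the first one.
  set q : ℂ := Complex.I * b * (‖c‖ ^ 2 : ℝ) / (1 - Complex.I * b * d ^ 2) with hq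
  have hq1 : q.re < 1 := re_lt_one_of_mul_eq (b := b) (r := ‖c‖ ^ 2) (e := d ^ 2) (by positivity)
    (by positivity) (by rw [hq]; push_cast; field_simp)
  have h1 : ∀ x : ℂ, ∫ y, Complex.exp (((a * ‖x‖ ^ 2 + b * ‖c * x + d * y‖ ^ 2 : ℝ) : ℂ) *
      Complex.I) ∂stdComplexGaussian = (1 - Complex.I * b * d ^ 2)⁻¹ *
        Complex.exp ((Complex.I * a + q) * ((‖0 + (1 : ℝ) * x‖ ^ 2 : ℝ) : ℂ)) := by
    intro x
    have h2 : ∀ y : ℂ, Complex.exp (((a * ‖x‖ ^ 2 + b * ‖c * x + d * y‖ ^ 2 : ℝ) : ℂ) *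
        Complex.I) = Complex.exp (Complex.I * a * (‖x‖ ^ 2 : ℝ)) *
          Complex.exp ((Complex.I * b) * ((‖c * x + d * y‖ ^ 2 : ℝ) : ℂ)) := by
      intro y
      rw [← Complex.exp_add]
      congr 1
      push_cast
      ring
    simp only [h2]
    rw [integral_const_mul, integral_cexp_norm_sq (by
      have : (Complex.I * b * d ^ 2).re = 0 := by
        have : Complex.I * b * d ^ 2 = ((b * d ^ 2 : ℝ) : ℂ) * Complex.I := by push_cast; ring
        rw [this, Complex.re_ofReal_mul, Complex.I_re, mul_zero]
      rw [this]; exact one_pos), mul_left_comm, ← Complex.exp_add]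
    congr 2
    rw [hq, norm_mul]
    simp
    field_simp
  simp only [h1]
  have hlt : ((Complex.I * a + q) * ((1 : ℝ) : ℂ) ^ 2).re < 1 := by simpa using hq1
  rw [integral_const_mul, integral_cexp_norm_sq hlt]
  simp only [norm_zero, Complex.ofReal_one, one_pow, mul_one]
  simp only [ne_eq, OfNat.ofNat_ne_zero, not_false_eq_true, zero_pow, Complex.ofReal_zero,
    mul_zero, zero_div, Complex.exp_zero, mul_one]
  rw [← mul_inv]
  congr 1
  have hd : (d : ℂ) ^ 2 = 1 - (‖c‖ : ℂ) ^ 2 := by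
    rw [eq_sub_iff_add_eq, add_comm]
    exact_mod_cast hcd
  have hqq : (1 - Complex.I * (b : ℂ) * (d : ℂ) ^ 2) * q = Complex.I * b * (‖c‖ ^ 2 : ℝ) := by
    rw [hq]; field_simp
  rw [mul_sub, mul_add, hqq, hd]
  push_cast
  linear_combination (a * b * (1 - (‖c‖ : ℂ) ^ 2)) * Complex.I_sq

/-! Laws determined by characteristic functions -/

lemma ext_of_integral_cexp_real {P Q : Measure (ℝ × ℝ)} [IsFiniteMeasure P] [IsFiniteMeasure Q]
    (h : ∀ a b : ℝ, ∫ p, Complex.exp (((a * p.1 + b * p.2 : ℝ) : ℂ) * Complex.I) ∂P =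
      ∫ p, Complex.exp (((a * p.1 + b * p.2 : ℝ) : ℂ) * Complex.I) ∂Q) : P = Q := by
  refine Measure.ext_of_charFunDual (funext fun l => ?_)
  rw [charFunDual_apply, charFunDual_apply]
  obtain ⟨a, b, hl⟩ : ∃ a b : ℝ, ∀ p : ℝ × ℝ, l p = a * p.1 + b * p.2 := by
    refine ⟨l (1, 0), l (0, 1), fun p => ?_⟩
    have hp : p = p.1 • ((1 : ℝ), (0 : ℝ)) + p.2 • ((0 : ℝ), (1 : ℝ)) := by ext <;> simp
    conv_lhs => rw [hp, map_add, map_smul, map_smul]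
    simp only [smul_eq_mul]
    ring
  simp only [hl]
  exact h _ _

lemma ext_of_integral_cexp_complex {P Q : Measure (ℂ × ℂ)} [IsFiniteMeasure P] [IsFiniteMeasure Q]
    (h : ∀ z w : ℂ, ∫ p, Complex.exp (((z * p.1 + w * p.2).re : ℝ) * Complex.I) ∂P =
      ∫ p, Complex.exp (((z * p.1 + w * p.2).re : ℝ) * Complex.I) ∂Q) : P = Q := by
  refine Measure.ext_of_charFunDual (funext fun l => ?_)
  rw [charFunDual_apply, charFunDual_apply]
  obtain ⟨z, w, hl⟩ : ∃ z w : ℂ, ∀ p : ℂ × ℂ, l p = (z * p.1 + w * p.2).re := by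
    -- The minus signs compensate for Re(zp) = Re z Re p - Im z Im p.
    refine ⟨⟨l (1, 0), -l (Complex.I, 0)⟩, ⟨l (0, 1), -l (0, Complex.I)⟩, fun p => ?_⟩
    have hp : p = p.1.re • ((1 : ℂ), (0 : ℂ)) + p.1.im • ((Complex.I : ℂ), (0 : ℂ)) +
        (p.2.re • ((0 : ℂ), (1 : ℂ)) + p.2.im • ((0 : ℂ), Complex.I)) := by
      ext <;> simp
    conv_lhs => rw [hp, map_add, map_add, map_add, map_smul, map_smul, map_smul, map_smul]
    simp only [smul_eq_mul, Complex.add_re, Complex.mul_re]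
    ring
  simp only [hl]
  exact h _ _

/-! ### Reduction of correlated combinations to a canonical Gaussian pair -/

section Pair

variable {Ω : Type*} [MeasurableSpace Ω] {μ : Measure Ω} [IsProbabilityMeasure μ]

lemma normSq_add_expand (z w : ℂ) :
    ‖z + w‖ ^ 2 = ‖z‖ ^ 2 + ‖w‖ ^ 2 + 2 * (z * starRingEnd ℂ w).re := by
  simp only [← Complex.normSq_eq_norm_sq, Complex.normSq_add]

/-- Two unit linear combinations of independent standard complex Gaussians have the law of the
canonical pair with the same correlation. -/
lemma map_linearCombination_eq {κ : Type*} [Fintype κ] {G : κ → Ω → ℂ}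
    (hG : ∀ p, HasLaw (G p) stdComplexGaussian μ) (hind : iIndepFun G μ) {α β : κ → ℂ}
    (hα : ∑ p, ‖α p‖ ^ 2 = 1) (hβ : ∑ p, ‖β p‖ ^ 2 = 1) {c : ℂ} {d : ℝ}
    (hc : ∑ p, β p * starRingEnd ℂ (α p) = c) (hcd : ‖c‖ ^ 2 + d ^ 2 = 1) :
    μ.map (fun ω => (∑ p, α p * G p ω, ∑ p, β p * G p ω)) =
      (stdComplexGaussian.prod stdComplexGaussian).map (fun g => (g.1, c * g.1 + d * g.2)) := by
  have hGm : ∀ p, AEMeasurable (G p) μ := fun p => (hG p).aemeasurable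
  have hm : AEMeasurable (fun ω => (∑ p, α p * G p ω, ∑ p, β p * G p ω)) μ := by fun_prop
  have hm2 : Measurable (fun g : ℂ × ℂ => (g.1, c * g.1 + d * g.2)) := by fun_prop
  have := Measure.isProbabilityMeasure_map hm
  have := Measure.isProbabilityMeasure_map (μ := stdComplexGaussian.prod stdComplexGaussian)
    hm2.aemeasurable
  refine ext_of_integral_cexp_complex fun z w => ?_
  rw [integral_map hm (by fun_prop : Measurable _).aestronglyMeasurable,
    integral_map hm2.aemeasurable (by fun_prop : Measurable _).aestronglyMeasurable]
  have hL : ∫ ω, Complex.exp (((z * ∑ p, α p * G p ω + w * ∑ p, β p * G p ω).re : ℝ) * Complex.I)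
      ∂μ = ∏ p, Complex.exp (-((‖z * α p + w * β p‖ ^ 2 : ℝ) : ℂ) / 4) := by
    have h1 : ∀ ω, Complex.exp (((z * ∑ p, α p * G p ω + w * ∑ p, β p * G p ω).re : ℝ) *
        Complex.I) = ∏ p, (fun g : ℂ => Complex.exp ((((z * α p + w * β p) * g).re : ℝ) *
          Complex.I)) (G p ω) := by
      intro ω
      rw [← Complex.exp_sum, ← Finset.sum_mul, ← Complex.ofReal_sum, ← Complex.re_sum]
      congr 4
      rw [Finset.mul_sum, Finset.mul_sum, ← Finset.sum_add_distrib]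
      exact Finset.sum_congr rfl fun p _ => by ring
    rw [integral_congr_ae (ae_of_all _ h1), hind.integral_fun_prod_comp (f := fun p g =>
      Complex.exp ((((z * α p + w * β p) * g).re : ℝ) * Complex.I)) hGm
      (fun p => (by fun_prop : Measurable _).aestronglyMeasurable)]
    refine Finset.prod_congr rfl fun p _ => ?_
    rw [← integral_cexp_re_mul, ← (hG p).map_eq, integral_map (hGm p)
      (by fun_prop : Measurable _).aestronglyMeasurable]
  have hR : ∫ g : ℂ × ℂ, Complex.exp (((z * g.1 + w * (c * g.1 + d * g.2)).re : ℝ) * Complex.I)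
      ∂(stdComplexGaussian.prod stdComplexGaussian) =
        Complex.exp (-((‖z + w * c‖ ^ 2 : ℝ) : ℂ) / 4) *
          Complex.exp (-((‖w * d‖ ^ 2 : ℝ) : ℂ) / 4) := by
    rw [← integral_cexp_re_mul, ← integral_cexp_re_mul, ← integral_prod_mul]
    congr 1
    ext g
    rw [← Complex.exp_add, ← add_mul, ← Complex.ofReal_add, ← Complex.add_re]
    congr 4
    ring
  rw [hL, hR, ← Complex.exp_sum, ← Complex.exp_add]
  congr 1
  -- Both characteristic functions are Gaussian; this equates their quadratic forms, each being |z|²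
  -- + |w|² + 2 Re(z conj(wc)).
  have key : ∑ p, ‖z * α p + w * β p‖ ^ 2 = ‖z + w * c‖ ^ 2 + ‖w * d‖ ^ 2 := by
    simp only [normSq_add_expand, Finset.sum_add_distrib, norm_mul, mul_pow, ← Finset.mul_sum,
      hα, hβ, ← Complex.re_sum]
    have h2 : ∑ p, z * α p * starRingEnd ℂ (w * β p) = z * starRingEnd ℂ (w * c) := by
      rw [← hc, map_mul, map_sum, Finset.mul_sum, Finset.mul_sum]
      refine Finset.sum_congr rfl fun p _ => ?_
      simp only [map_mul, Complex.conj_conj]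
      ring
    rw [h2, Complex.norm_real, Real.norm_eq_abs, sq_abs]
    linear_combination (-‖w‖ ^ 2) * hcd
  rw [← Finset.sum_div, Finset.sum_neg_distrib, ← Complex.ofReal_sum, key]
  push_cast
  ring

/-- Independence of a doubly indexed family gives independence of its rows. -/
lemma iIndepFun_curry {ι κ X : Type*} [Countable ι] [Countable κ] [MeasurableSpace X]
    {G : ι × κ → Ω → X}
    (hG : ∀ p, AEMeasurable (G p) μ) (hind : iIndepFun G μ) :
    iIndepFun (fun i ω j => G (i, j) ω) μ := by
  have : ∀ p, IsProbabilityMeasure (μ.map (G p)) := fun p =>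
    Measure.isProbabilityMeasure_map (hG p)
  have h1 := (iIndepFun_iff_map_fun_eq_infinitePi_map₀' hG).1 hind
  have hrow : ∀ i, AEMeasurable (fun ω j => G (i, j) ω) μ := fun i =>
    aemeasurable_pi_lambda _ fun j => hG (i, j)
  rw [iIndepFun_iff_map_fun_eq_infinitePi_map₀' hrow]
  have h2 := Measure.infinitePi_map_curry (fun (i : ι) (j : κ) => μ.map (G (i, j)))
  have h3 : ∀ i, μ.map (fun ω j => G (i, j) ω) = Measure.infinitePi fun j => μ.map (G (i, j)) :=
    fun i => (iIndepFun_iff_map_fun_eq_infinitePi_map₀' fun j => hG (i, j)).1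
      (hind.precomp (g := fun j => (i, j)) fun _ _ h => (Prod.mk.inj h).2)
  simp only [h3]
  rw [← h2, ← h1, AEMeasurable.map_map_of_aemeasurable
    (MeasurableEquiv.curry ι κ X).measurable.aemeasurable (aemeasurable_pi_lambda _ hG)]
  rfl

end Pair

/-! The joint law of the squared norms: a mixture of products of Gamma laws -/

/-- Integration by parts in m with the complex rate z = l - ia: the modulus of e^{-zx} is e^{-lx},
so the real bounds control everything. -/
lemma integral_pow_mul_cexp_neg (m : ℕ) {l : ℝ} (hl : 0 < l) (a : ℝ) :
    ∫ x in Ioi (0 : ℝ), (x : ℂ) ^ m * Complex.exp (-((l - a * Complex.I) * x)) =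
      m.factorial / (l - a * Complex.I) ^ (m + 1) := by
  set z : ℂ := l - a * Complex.I with hz
  have hre : z.re = l := by simp [hz]
  have hz0 : z ≠ 0 := fun h => by rw [h] at hre; simp at hre; linarith
  have hnorm : ∀ (k : ℕ) {x : ℝ}, 0 < x → ‖(x : ℂ) ^ k * Complex.exp (-(z * x))‖ =
      x ^ k * Real.exp (-(l * x)) := by
    intro k x hx
    rw [norm_mul, norm_pow, Complex.norm_real, Complex.norm_exp, Real.norm_of_nonneg hx.le,
      Complex.neg_re, Complex.re_mul_ofReal, hre]
  have hI : ∀ k : ℕ, IntegrableOn (fun x : ℝ => (x : ℂ) ^ k * Complex.exp (-(z * x))) (Ioi 0) := by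
    intro k
    refine Integrable.mono' (integrableOn_pow_mul_exp_neg k hl)
      (by fun_prop : Measurable _).aestronglyMeasurable ?_
    refine (ae_restrict_iff' measurableSet_Ioi).2 (ae_of_all _ fun x (hx : 0 < x) => ?_)
    rw [hnorm k hx]
  have ht : ∀ k : ℕ, Tendsto (fun x : ℝ => (x : ℂ) ^ k * Complex.exp (-(z * x))) atTop (𝓝 0) := by
    intro k
    rw [tendsto_zero_iff_norm_tendsto_zero]
    refine (tendsto_pow_mul_exp_neg k hl).congr' ?_
    filter_upwards [eventually_gt_atTop 0] with x hx
    rw [hnorm k hx]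
  have hd : ∀ x : ℝ, HasDerivAt (fun x : ℝ => Complex.exp (-(z * x)))
      (Complex.exp (-(z * x)) * -z) x := by
    intro x
    have h1 : HasDerivAt (fun x : ℝ => -(z * (x : ℂ))) (-z) x :=
      (((hasDerivAt_id x).ofReal_comp.const_mul z).neg).congr_deriv (by simp)
    exact h1.cexp
  induction m with
  | zero =>
    have h := integral_Ioi_of_hasDerivAt_of_tendsto' (a := 0) (m := 0)
      (f := fun x : ℝ => -z⁻¹ * ((x : ℂ) ^ 0 * Complex.exp (-(z * x))))
      (f' := fun x : ℝ => (x : ℂ) ^ 0 * Complex.exp (-(z * x))) (fun x _ => by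
        simp only [pow_zero, one_mul]
        refine ((hd x).const_mul (-z⁻¹)).congr_deriv ?_
        field_simp) (hI 0) (by simpa using (ht 0).const_mul (-z⁻¹))
    rw [h]
    simp
  | succ m ih =>
    have h := integral_Ioi_of_hasDerivAt_of_tendsto' (a := 0) (m := 0)
      (f := fun x : ℝ => ((x : ℂ) ^ (m + 1) * Complex.exp (-(z * x))))
      (f' := fun x : ℝ => (m + 1 : ℂ) * ((x : ℂ) ^ m * Complex.exp (-(z * x))) -
        z * ((x : ℂ) ^ (m + 1) * Complex.exp (-(z * x)))) (fun x _ => by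
        have h1 : HasDerivAt (fun x : ℝ => (x : ℂ) ^ (m + 1)) ((m + 1 : ℂ) * (x : ℂ) ^ m) x :=
          ((hasDerivAt_id x).ofReal_comp.pow (m + 1)).congr_deriv (by simp)
        refine (h1.mul (hd x)).congr_deriv ?_
        ring) (((hI m).const_mul _).sub ((hI (m + 1)).const_mul _)) (ht (m + 1))
    rw [integral_sub ((hI m).const_mul _) ((hI (m + 1)).const_mul _), integral_const_mul,
      integral_const_mul, ih] at h
    simp at h
    rw [sub_eq_zero] at h
    rw [← mul_right_inj' hz0, ← h, Nat.factorial_succ]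
    push_cast
    field_simp
    ring

lemma ofReal_sub_mul_I_ne_zero {l : ℝ} (hl : 0 < l) (a : ℝ) : (l : ℂ) - a * Complex.I ≠ 0 :=
  fun h => by
    have := congrArg Complex.re h
    simp at this
    linarith

lemma integral_cexp_gammaMeasure (m : ℕ) {l : ℝ} (hl : 0 < l) (a : ℝ) :
    ∫ x : ℝ, Complex.exp (((a * x : ℝ) : ℂ) * Complex.I) ∂gammaMeasure (m + 1 : ℕ) l =
      (l / (l - a * Complex.I)) ^ (m + 1) := by
  have hne := ofReal_sub_mul_I_ne_zero hl a
  have hf : (m.factorial : ℂ) ≠ 0 := by exact_mod_cast m.factorial_ne_zero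
  rw [integral_gammaMeasure _ _ hl]
  have h1 : ∀ x : ℝ, gammaDensity m l x • Complex.exp (((a * x : ℝ) : ℂ) * Complex.I) =
      (l : ℂ) ^ (m + 1) / m.factorial *
        ((x : ℂ) ^ m * Complex.exp (-((l - a * Complex.I) * x))) := by
    intro x
    rw [gammaDensity, Complex.real_smul]
    push_cast
    rw [mul_assoc, mul_assoc, ← Complex.exp_add]
    congr 4
    ring
  simp only [h1]
  rw [integral_const_mul, integral_pow_mul_cexp_neg m hl, div_pow]
  field_simp

lemma isProbabilityMeasure_gammaMeasure_nat (m : ℕ) {l : ℝ} (hl : 0 < l) :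
    IsProbabilityMeasure (gammaMeasure (m + 1 : ℕ) l) :=
  isProbabilityMeasure_gammaMeasure (by positivity) hl

/-- The weights of the negative binomial law. -/
noncomputable def negBinomialWeight (m : ℕ) (r : ℝ) (t : ℕ) : ℝ :=
  (1 - r) ^ (m + 1) * ((t + m).choose m * r ^ t)

lemma negBinomialWeight_nonneg (m : ℕ) {r : ℝ} (hr : 0 ≤ r) (hr1 : r < 1) (t : ℕ) :
    0 ≤ negBinomialWeight m r t := by
  have : 0 < 1 - r := by linarith
  unfold negBinomialWeight
  positivity

/-- Kibble's bivariate Gamma law. -/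
noncomputable def gammaMixture (m : ℕ) (r : ℝ) : Measure (ℝ × ℝ) :=
  Measure.sum fun t : ℕ => ENNReal.ofReal (negBinomialWeight m r t) •
    (gammaMeasure (m + t + 1 : ℕ) (1 - r)⁻¹).prod (gammaMeasure (m + t + 1 : ℕ) (1 - r)⁻¹)

lemma isFiniteMeasure_gammaMixture (m : ℕ) {r : ℝ} (hr : 0 ≤ r) (hr1 : r < 1) :
    IsFiniteMeasure (gammaMixture m r) := by
  have hl : 0 < (1 - r)⁻¹ := inv_pos.2 (by linarith)
  have hs : Summable (negBinomialWeight m r) :=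
    (summable_choose_mul_geometric_of_norm_lt_one m
      (by rwa [Real.norm_of_nonneg hr] : ‖r‖ < 1)).mul_left _
  refine ⟨?_⟩
  rw [gammaMixture, Measure.sum_apply _ MeasurableSet.univ]
  have h : ∀ t : ℕ, (ENNReal.ofReal (negBinomialWeight m r t) •
      (gammaMeasure (m + t + 1 : ℕ) (1 - r)⁻¹).prod (gammaMeasure (m + t + 1 : ℕ) (1 - r)⁻¹)) univ =
      ENNReal.ofReal (negBinomialWeight m r t) := by
    intro t
    have := isProbabilityMeasure_gammaMeasure_nat (m + t) hl
    rw [Measure.smul_apply, measure_univ, smul_eq_mul, mul_one]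
  simp only [h]
  exact hs.tsum_ofReal_lt_top

/-- Each component is a product measure, so the integral of a product factors there. Integrability
against the whole mixture is what makes the series converge. -/
lemma hasSum_integral_gammaMixture {m : ℕ} {r : ℝ} (hr : 0 ≤ r) (hr1 : r < 1) {𝕜 : Type*}
    [RCLike 𝕜] {f h : ℝ → 𝕜} (hf : Integrable (fun p : ℝ × ℝ => f p.1 * h p.2) (gammaMixture m r)) :
    HasSum (fun t : ℕ => negBinomialWeight m r t •
      ((∫ x, f x ∂gammaMeasure (m + t + 1 : ℕ) (1 - r)⁻¹) *
        ∫ x, h x ∂gammaMeasure (m + t + 1 : ℕ) (1 - r)⁻¹))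
      (∫ p, f p.1 * h p.2 ∂gammaMixture m r) := by
  have hl : 0 < (1 - r)⁻¹ := inv_pos.2 (by linarith)
  refine (hasSum_integral_measure hf).congr_fun fun t => ?_
  have := isProbabilityMeasure_gammaMeasure_nat (m + t) hl
  rw [integral_smul_measure, ENNReal.toReal_ofReal (negBinomialWeight_nonneg m hr hr1 t),
    integral_prod_mul]

lemma norm_div_sub_mul_I_le_one {l : ℝ} (hl : 0 < l) (a : ℝ) :
    ‖(l : ℂ) / (l - a * Complex.I)‖ ≤ 1 := by
  rw [norm_div]
  refine div_le_one_of_le₀ ?_ (norm_nonneg _)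
  rw [Complex.norm_real, Real.norm_of_nonneg hl.le]
  refine le_trans (le_of_eq ?_) (Complex.re_le_norm _)
  simp

/-- With A and B the characteristic functions of the exponential law of rate 1/(1-r), component t
contributes (AB)^{m+t+1}. The negative binomial series, valid since |rAB| < 1, sums these to
((1-r)AB/(1 - rAB))^{m+1}, and `hval` rewrites the base. -/
lemma integral_cexp_gammaMixture (m : ℕ) {r : ℝ} (hr : 0 ≤ r) (hr1 : r < 1) (a b : ℝ) :
    ∫ p, Complex.exp (((a * p.1 + b * p.2 : ℝ) : ℂ) * Complex.I) ∂gammaMixture m r =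
      (1 - Complex.I * a - Complex.I * b - (1 - r : ℝ) * a * b)⁻¹ ^ (m + 1) := by
  have := isFiniteMeasure_gammaMixture m hr hr1
  have h1r : 0 < 1 - r := by linarith
  have hl : 0 < (1 - r)⁻¹ := inv_pos.2 h1r
  have hsplit : ∀ p : ℝ × ℝ, Complex.exp (((a * p.1 + b * p.2 : ℝ) : ℂ) * Complex.I) =
      Complex.exp (((a * p.1 : ℝ) : ℂ) * Complex.I) *
        Complex.exp (((b * p.2 : ℝ) : ℂ) * Complex.I) := by
    intro p
    rw [← Complex.exp_add]
    congr 1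
    push_cast
    ring
  have hint : Integrable (fun p : ℝ × ℝ => Complex.exp (((a * p.1 : ℝ) : ℂ) * Complex.I) *
      Complex.exp (((b * p.2 : ℝ) : ℂ) * Complex.I)) (gammaMixture m r) := by
    refine Integrable.of_bound (C := 1) (by fun_prop : Measurable _).aestronglyMeasurable
      (ae_of_all _ fun g => ?_)
    rw [norm_mul, Complex.norm_exp_ofReal_mul_I, Complex.norm_exp_ofReal_mul_I, one_mul]
  have hs := hasSum_integral_gammaMixture hr hr1
    (f := fun x => Complex.exp (((a * x : ℝ) : ℂ) * Complex.I))
    (h := fun x => Complex.exp (((b * x : ℝ) : ℂ) * Complex.I)) hint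
  simp only [hsplit]
  refine hs.unique ?_
  set A : ℂ := ((1 - r)⁻¹ : ℝ) / (((1 - r)⁻¹ : ℝ) - a * Complex.I) with hA
  set B : ℂ := ((1 - r)⁻¹ : ℝ) / (((1 - r)⁻¹ : ℝ) - b * Complex.I) with hB
  have hA1 : ‖A‖ ≤ 1 := norm_div_sub_mul_I_le_one hl a
  have hB1 : ‖B‖ ≤ 1 := norm_div_sub_mul_I_le_one hl b
  have hq : ‖(r : ℂ) * (A * B)‖ < 1 := by
    rw [norm_mul, norm_mul, Complex.norm_real, Real.norm_of_nonneg hr]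
    have : ‖A‖ * ‖B‖ ≤ 1 := mul_le_one₀ hA1 (norm_nonneg _) hB1
    nlinarith
  have hg := (hasSum_choose_mul_geometric_of_norm_lt_one m hq).mul_left
    (((1 - r : ℝ) : ℂ) ^ (m + 1) * (A * B) ^ (m + 1))
  have hc1 : ((1 - r : ℝ) : ℂ) ≠ 0 := by exact_mod_cast h1r.ne'
  have hca := ofReal_sub_mul_I_ne_zero hl a
  have hcb := ofReal_sub_mul_I_ne_zero hl b
  have hD : 1 - (r : ℂ) * (A * B) ≠ 0 := fun h0 => by
    rw [← sub_eq_zero.1 h0] at hq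
    simp at hq
  have hval : (1 - Complex.I * a - Complex.I * b - (1 - r : ℝ) * a * b) *
      (((1 - r : ℝ) : ℂ) * (A * B)) = 1 - (r : ℂ) * (A * B) := by
    have hA' : A * (1 - (1 - r : ℝ) * a * Complex.I) = 1 := by
      have h2 : ((((1 - r)⁻¹ : ℝ) : ℂ) - a * Complex.I) * (1 - r : ℝ) =
        (1 - (1 - r : ℝ) * a * Complex.I) := by
        push_cast at hc1 ⊢
        field_simp
      rw [← h2, ← mul_assoc, hA, div_mul_cancel₀ _ hca]
      push_cast at hc1 ⊢
      field_simp
    have hB' : B * (1 - (1 - r : ℝ) * b * Complex.I) = 1 := by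
      have h2 : ((((1 - r)⁻¹ : ℝ) : ℂ) - b * Complex.I) * (1 - r : ℝ) =
        (1 - (1 - r : ℝ) * b * Complex.I) := by
        push_cast at hc1 ⊢
        field_simp
      rw [← h2, ← mul_assoc, hB, div_mul_cancel₀ _ hcb]
      push_cast at hc1 ⊢
      field_simp
    push_cast at hA' hB' ⊢
    linear_combination (B * (1 - (1 - r) * b * Complex.I)) * hA' + hB' -
      (1 - r) ^ 2 * a * b * A * B * Complex.I_sq
  have hv : (1 - Complex.I * a - Complex.I * b - (1 - r : ℝ) * a * b)⁻¹ =
      (((1 - r : ℝ) : ℂ) * (A * B)) / (1 - (r : ℂ) * (A * B)) := by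
    have h0 : (1 - Complex.I * a - Complex.I * b - (1 - r : ℝ) * a * b) ≠ 0 := fun h0 => by
      rw [h0, zero_mul] at hval
      exact hD hval.symm
    rw [eq_div_iff hD, ← hval, inv_mul_cancel_left₀ h0]
  rw [hv, div_pow, mul_pow]
  have hg' := hg
  rw [mul_one_div] at hg'
  refine hg'.congr_fun fun t => ?_
  rw [integral_cexp_gammaMeasure _ hl, integral_cexp_gammaMeasure _ hl, ← hA, ← hB,
    negBinomialWeight, Complex.real_smul]
  push_cast
  ring

lemma aemeasurable_sum_norm_sq {Ω : Type*} [MeasurableSpace Ω] {μ : Measure Ω} {ι κ : Type*}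
    [Fintype ι] [Fintype κ] {G : ι × κ → Ω → ℂ}
    (hG : ∀ p, HasLaw (G p) stdComplexGaussian μ) (α : κ → ℂ) :
    AEMeasurable (fun ω => ∑ i, ‖∑ p, α p * G (i, p) ω‖ ^ 2) μ := by
  have hGm : ∀ p, AEMeasurable (G p) μ := fun p => (hG p).aemeasurable
  fun_prop

section NormSq

variable {Ω : Type*} [MeasurableSpace Ω] {μ : Measure Ω} [IsProbabilityMeasure μ]
  {ι κ : Type*} [Fintype ι] [Fintype κ] {G : ι × κ → Ω → ℂ} {α β : κ → ℂ} {c : ℂ}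

/-- The rows i are independent, and each has the law of the canonical pair with d = √(1 - |c|²). The
degenerate value |c| = 1, that is d = 0, is included. -/
lemma integral_cexp_sum_norm_sq (hG : ∀ p, HasLaw (G p) stdComplexGaussian μ)
    (hind : iIndepFun G μ) (hα : ∑ p, ‖α p‖ ^ 2 = 1) (hβ : ∑ p, ‖β p‖ ^ 2 = 1)
    (hc : ∑ p, β p * starRingEnd ℂ (α p) = c) (hc1 : ‖c‖ ≤ 1) (a b : ℝ) :
    ∫ ω, Complex.exp (((a * (∑ i, ‖∑ p, α p * G (i, p) ω‖ ^ 2) +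
      b * (∑ i, ‖∑ p, β p * G (i, p) ω‖ ^ 2) : ℝ) : ℂ) * Complex.I) ∂μ =
      (1 - Complex.I * a - Complex.I * b - (1 - ‖c‖ ^ 2 : ℝ) * a * b)⁻¹ ^ Fintype.card ι := by
  have hGm : ∀ p, AEMeasurable (G p) μ := fun p => (hG p).aemeasurable
  let F : (κ → ℂ) → ℂ := fun g => Complex.exp (((a * ‖∑ p, α p * g p‖ ^ 2 +
    b * ‖∑ p, β p * g p‖ ^ 2 : ℝ) : ℂ) * Complex.I)
  have hF : Measurable F := by fun_prop
  have h1 : ∀ ω, Complex.exp (((a * (∑ i, ‖∑ p, α p * G (i, p) ω‖ ^ 2) +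
      b * (∑ i, ‖∑ p, β p * G (i, p) ω‖ ^ 2) : ℝ) : ℂ) * Complex.I) =
      ∏ i, F (fun p => G (i, p) ω) := by
    intro ω
    rw [← Complex.exp_sum, ← Finset.sum_mul, ← Complex.ofReal_sum, Finset.mul_sum, Finset.mul_sum,
      ← Finset.sum_add_distrib]
  rw [integral_congr_ae (ae_of_all _ h1), (iIndepFun_curry hGm hind).integral_fun_prod_comp
    (f := fun _ => F) (fun i => aemeasurable_pi_lambda _ fun p => hGm (i, p))
    (fun i => hF.aestronglyMeasurable)]
  have hd : ‖c‖ ^ 2 + Real.sqrt (1 - ‖c‖ ^ 2) ^ 2 = 1 := by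
    rw [Real.sq_sqrt (by nlinarith [norm_nonneg c])]
    ring
  have h2 : ∀ i, ∫ ω, F (fun p => G (i, p) ω) ∂μ =
      (1 - Complex.I * a - Complex.I * b - (1 - ‖c‖ ^ 2 : ℝ) * a * b)⁻¹ := by
    intro i
    have hlaw := map_linearCombination_eq (μ := μ) (G := fun p => G (i, p)) (fun p => hG (i, p))
      (hind.precomp (g := fun p => (i, p)) fun _ _ h => (Prod.mk.inj h).2) hα hβ hc hd
    have hm : AEMeasurable (fun ω => (∑ p, α p * G (i, p) ω, ∑ p, β p * G (i, p) ω)) μ := by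
      fun_prop
    have hE : Measurable (fun g : ℂ × ℂ => Complex.exp (((a * ‖g.1‖ ^ 2 + b * ‖g.2‖ ^ 2 : ℝ) : ℂ) *
      Complex.I)) := by fun_prop
    rw [← integral_cexp_norm_sq_pair a b hd]
    have h3 := integral_map hm (f := fun g : ℂ × ℂ =>
      Complex.exp (((a * ‖g.1‖ ^ 2 + b * ‖g.2‖ ^ 2 : ℝ) : ℂ) * Complex.I)) hE.aestronglyMeasurable
    rw [hlaw, integral_map (by fun_prop : Measurable _).aemeasurable hE.aestronglyMeasurable] at h3
    exact h3.symm
  simp only [h2, Finset.prod_const, Finset.card_univ]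

theorem map_sum_norm_sq_eq_gammaMixture (hG : ∀ p, HasLaw (G p) stdComplexGaussian μ)
    (hind : iIndepFun G μ) (hα : ∑ p, ‖α p‖ ^ 2 = 1) (hβ : ∑ p, ‖β p‖ ^ 2 = 1)
    (hc : ∑ p, β p * starRingEnd ℂ (α p) = c) (hc1 : ‖c‖ < 1) {m : ℕ}
    (hm : Fintype.card ι = m + 1) :
    μ.map (fun ω => (∑ i, ‖∑ p, α p * G (i, p) ω‖ ^ 2, ∑ i, ‖∑ p, β p * G (i, p) ω‖ ^ 2)) =
      gammaMixture m (‖c‖ ^ 2) := by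
  have hr1 : ‖c‖ ^ 2 < 1 := by nlinarith [norm_nonneg c]
  have := isFiniteMeasure_gammaMixture m (sq_nonneg ‖c‖) hr1
  have hXY := (aemeasurable_sum_norm_sq hG α).prodMk (aemeasurable_sum_norm_sq hG β)
  refine ext_of_integral_cexp_real fun a b => ?_
  rw [integral_map hXY (by fun_prop : Measurable _).aestronglyMeasurable,
    integral_cexp_gammaMixture m (sq_nonneg _) hr1,
    integral_cexp_sum_norm_sq hG hind hα hβ hc hc1.le, hm]

/-- For |c| = 1 the term in ab disappears and the characteristic function is that of Gamma(m+1, 1)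
at a + b, which is how a law on the diagonal looks. -/
theorem map_sum_norm_sq_eq_diag (hG : ∀ p, HasLaw (G p) stdComplexGaussian μ)
    (hind : iIndepFun G μ) (hα : ∑ p, ‖α p‖ ^ 2 = 1) (hβ : ∑ p, ‖β p‖ ^ 2 = 1)
    (hc : ∑ p, β p * starRingEnd ℂ (α p) = c) (hc1 : ‖c‖ = 1) {m : ℕ}
    (hm : Fintype.card ι = m + 1) :
    μ.map (fun ω => (∑ i, ‖∑ p, α p * G (i, p) ω‖ ^ 2, ∑ i, ‖∑ p, β p * G (i, p) ω‖ ^ 2)) =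
      (gammaMeasure (m + 1 : ℕ) 1).map (fun x => (x, x)) := by
  have := isProbabilityMeasure_gammaMeasure_nat m one_pos
  have hXY := (aemeasurable_sum_norm_sq hG α).prodMk (aemeasurable_sum_norm_sq hG β)
  refine ext_of_integral_cexp_real fun a b => ?_
  rw [integral_map hXY (by fun_prop : Measurable _).aestronglyMeasurable,
    integral_cexp_sum_norm_sq hG hind hα hβ hc hc1.le, hm,
    integral_map (by fun_prop : Measurable _).aemeasurable
      (by fun_prop : Measurable _).aestronglyMeasurable]
  have h := integral_cexp_gammaMeasure m one_pos (a + b)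
  simp only [← add_mul]
  rw [h, hc1]
  congr 1
  rw [inv_eq_one_div]
  push_cast
  congr 1
  ring

/-- The case β = α, where c = 1, followed by projection to the first coordinate. -/
theorem hasLaw_sum_norm_sq (hG : ∀ p, HasLaw (G p) stdComplexGaussian μ)
    (hind : iIndepFun G μ) (hα : ∑ p, ‖α p‖ ^ 2 = 1) {m : ℕ} (hm : Fintype.card ι = m + 1) :
    HasLaw (fun ω => ∑ i, ‖∑ p, α p * G (i, p) ω‖ ^ 2) (gammaMeasure (m + 1 : ℕ) 1) μ := by
  have hX := aemeasurable_sum_norm_sq hG α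
  have hc : ∑ p, α p * starRingEnd ℂ (α p) = 1 := by
    simp only [Complex.mul_conj, Complex.normSq_eq_norm_sq]
    exact_mod_cast hα
  have h := map_sum_norm_sq_eq_diag hG hind hα hα hc norm_one hm
  refine ⟨hX, ?_⟩
  have h2 := congrArg (Measure.map Prod.fst) h
  rw [AEMeasurable.map_map_of_aemeasurable measurable_fst.aemeasurable (hX.prodMk hX),
    Measure.map_map measurable_fst (by fun_prop)] at h2
  simpa [Function.comp_def] using h2

/-! Moments of the logarithm of the squared norm -/

lemma memLp_log_sum_norm_sq (hG : ∀ p, HasLaw (G p) stdComplexGaussian μ)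
    (hind : iIndepFun G μ) (hα : ∑ p, ‖α p‖ ^ 2 = 1) {m : ℕ} (hm : Fintype.card ι = m + 1)
    {b : ℝ} (hb : 0 < b) :
    MemLp (fun ω => Real.log (1 + (∑ i, ‖∑ p, α p * G (i, p) ω‖ ^ 2) / b)) 2 μ := by
  have hlaw := hasLaw_sum_norm_sq hG hind hα hm
  have hlog : Measurable fun x : ℝ => Real.log (1 + x / b) := by fun_prop
  have h : MemLp (fun x => Real.log (1 + x / b)) 2 (gammaMeasure (m + 1 : ℕ) 1) := by
    rw [memLp_two_iff_integrable_sq hlog.aestronglyMeasurable,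
      integrable_gammaMeasure_iff _ _ one_pos]
    refine ((integrableOn_log_mul m one_pos hb 2).const_mul (1 / m.factorial)).congr
      (ae_of_all _ fun x => ?_)
    simp [gammaDensity]
    ring
  rw [← hlaw.map_eq] at h
  exact h.comp_of_map hlaw.aemeasurable

lemma integral_log_sum_norm_sq (hG : ∀ p, HasLaw (G p) stdComplexGaussian μ)
    (hind : iIndepFun G μ) (hα : ∑ p, ‖α p‖ ^ 2 = 1) {m : ℕ} (hm : Fintype.card ι = m + 1)
    {b : ℝ} (hb : 0 < b) :
    ∫ ω, Real.log (1 + (∑ i, ‖∑ p, α p * G (i, p) ω‖ ^ 2) / b) ∂μ =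
      Real.exp b * ∑ h ∈ Finset.Icc 1 (m + 1), expIntegral h b := by
  have hlaw := hasLaw_sum_norm_sq hG hind hα hm
  have h := integral_log_gammaMeasure m one_pos hb
  rw [mul_one] at h
  rw [← h, ← hlaw.map_eq, integral_map hlaw.aemeasurable
    (by fun_prop : Measurable _).aestronglyMeasurable]

lemma integral_log_mul_log_of_norm_eq_one (hG : ∀ p, HasLaw (G p) stdComplexGaussian μ)
    (hind : iIndepFun G μ) (hα : ∑ p, ‖α p‖ ^ 2 = 1) (hβ : ∑ p, ‖β p‖ ^ 2 = 1)
    (hc : ∑ p, β p * starRingEnd ℂ (α p) = c) (hc1 : ‖c‖ = 1) {m : ℕ}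
    (hm : Fintype.card ι = m + 1) (b : ℝ) :
    ∫ ω, Real.log (1 + (∑ i, ‖∑ p, α p * G (i, p) ω‖ ^ 2) / b) *
      Real.log (1 + (∑ i, ‖∑ p, β p * G (i, p) ω‖ ^ 2) / b) ∂μ =
      ∫ x, Real.log (1 + x / b) ^ 2 ∂gammaMeasure (m + 1 : ℕ) 1 := by
  have hXY := (aemeasurable_sum_norm_sq hG α).prodMk (aemeasurable_sum_norm_sq hG β)
  have hE : Measurable fun p : ℝ × ℝ => Real.log (1 + p.1 / b) * Real.log (1 + p.2 / b) := by
    fun_prop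
  have h := integral_map hXY (f := fun p : ℝ × ℝ => Real.log (1 + p.1 / b) *
    Real.log (1 + p.2 / b)) hE.aestronglyMeasurable
  rw [map_sum_norm_sq_eq_diag hG hind hα hβ hc hc1 hm,
    integral_map (by fun_prop : Measurable _).aemeasurable hE.aestronglyMeasurable] at h
  simp only [← pow_two] at h
  exact h.symm

/-- The product of two square integrable logarithms is integrable, so the mixture formula applies;
rate (1 - |c|²)⁻¹ gives the argument b/(1 - |c|²). -/
lemma hasSum_integral_log_mul_log (hG : ∀ p, HasLaw (G p) stdComplexGaussian μ)
    (hind : iIndepFun G μ) (hα : ∑ p, ‖α p‖ ^ 2 = 1) (hβ : ∑ p, ‖β p‖ ^ 2 = 1)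
    (hc : ∑ p, β p * starRingEnd ℂ (α p) = c) (hc1 : ‖c‖ < 1) {m : ℕ}
    (hm : Fintype.card ι = m + 1) {b : ℝ} (hb : 0 < b) :
    HasSum (fun t => negBinomialWeight m (‖c‖ ^ 2) t * (Real.exp (b / (1 - ‖c‖ ^ 2)) *
      ∑ h ∈ Finset.Icc 1 (m + t + 1), expIntegral h (b / (1 - ‖c‖ ^ 2))) ^ 2)
    (∫ ω, Real.log (1 + (∑ i, ‖∑ p, α p * G (i, p) ω‖ ^ 2) / b) *
      Real.log (1 + (∑ i, ‖∑ p, β p * G (i, p) ω‖ ^ 2) / b) ∂μ) := by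
  have hr1 : ‖c‖ ^ 2 < 1 := by nlinarith [norm_nonneg c]
  have hl : 0 < (1 - ‖c‖ ^ 2)⁻¹ := inv_pos.2 (by linarith)
  have hXY := (aemeasurable_sum_norm_sq hG α).prodMk (aemeasurable_sum_norm_sq hG β)
  have hE : Measurable fun p : ℝ × ℝ => Real.log (1 + p.1 / b) * Real.log (1 + p.2 / b) := by
    fun_prop
  have h := integral_map hXY (f := fun p : ℝ × ℝ => Real.log (1 + p.1 / b) *
    Real.log (1 + p.2 / b)) hE.aestronglyMeasurable
  have hint := (integrable_map_measure (f := fun ω => (∑ i, ‖∑ p, α p * G (i, p) ω‖ ^ 2,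
      ∑ i, ‖∑ p, β p * G (i, p) ω‖ ^ 2)) hE.aestronglyMeasurable hXY).2
    ((memLp_log_sum_norm_sq hG hind hα hm hb).integrable_mul
      (memLp_log_sum_norm_sq hG hind hβ hm hb))
  rw [map_sum_norm_sq_eq_gammaMixture hG hind hα hβ hc hc1 hm] at h hint
  have hs := hasSum_integral_gammaMixture (sq_nonneg _) hr1 (f := fun x => Real.log (1 + x / b))
    (h := fun x => Real.log (1 + x / b)) hint
  rw [h] at hs
  refine hs.congr_fun fun t => ?_
  rw [integral_log_gammaMeasure _ hl hb, smul_eq_mul, ← pow_two, div_eq_mul_inv]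

end NormSq

/-! Second-order statistics of the channel entries -/

lemma memLp_ofReal_gaussianReal : MemLp (fun x : ℝ => (x : ℂ)) 2 (gaussianReal 0 (1 / 2)) :=
  (memLp_id_gaussianReal 2).ofReal

lemma integral_id_stdComplexGaussian : ∫ g, g ∂stdComplexGaussian = 0 := by
  have hI := memLp_ofReal_gaussianReal.integrable (by norm_num)
  rw [integral_stdComplexGaussian, integral_add (hI.comp_fst _) ((hI.comp_snd _).mul_const _),
    integral_mul_const, integral_fun_fst (fun x : ℝ => (x : ℂ)),
    integral_fun_snd (fun x : ℝ => (x : ℂ)), integral_complex_ofReal]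
  simp

lemma memLp_id_stdComplexGaussian : MemLp (fun g : ℂ => g) 2 stdComplexGaussian := by
  have h1 : MemLp (fun p : ℝ × ℝ => (p.1 : ℂ)) 2
      ((gaussianReal 0 (1 / 2)).prod (gaussianReal 0 (1 / 2))) :=
    memLp_ofReal_gaussianReal.comp_measurePreserving measurePreserving_fst
  have h2 : MemLp (fun p : ℝ × ℝ => (p.2 : ℂ)) 2
      ((gaussianReal 0 (1 / 2)).prod (gaussianReal 0 (1 / 2))) :=
    memLp_ofReal_gaussianReal.comp_measurePreserving measurePreserving_snd
  have h3 := h1.add (h2.mul_const Complex.I)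
  rw [stdComplexGaussian, memLp_map_measure_iff (by fun_prop)
    Complex.measurableEquivRealProd.symm.measurable.aemeasurable]
  refine h3.congr_norm (by fun_prop) (ae_of_all _ fun p => ?_)
  congr 1
  apply Complex.ext <;> simp [Complex.measurableEquivRealProd]

lemma integral_mul_conj_stdComplexGaussian :
    ∫ g, g * starRingEnd ℂ g ∂stdComplexGaussian = 1 := by
  have hv : ∫ x : ℝ, x ^ 2 ∂gaussianReal 0 (1 / 2) = 1 / 2 := by
    have h := variance_fun_id_gaussianReal (μ := 0) (v := 1 / 2)
    rw [variance_eq_integral (by fun_prop)] at h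
    simpa using h
  have hI : Integrable (fun x : ℝ => x ^ 2) (gaussianReal 0 (1 / 2)) :=
    (memLp_id_gaussianReal 2).integrable_sq
  rw [integral_stdComplexGaussian]
  have h1 : ∀ p : ℝ × ℝ, ((p.1 : ℂ) + p.2 * Complex.I) *
      starRingEnd ℂ ((p.1 : ℂ) + p.2 * Complex.I) = ((p.1 ^ 2 + p.2 ^ 2 : ℝ) : ℂ) := by
    intro p
    rw [Complex.mul_conj, Complex.normSq_add_mul_I]
  simp only [h1]
  rw [integral_complex_ofReal, integral_add (hI.comp_fst _) (hI.comp_snd _),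
    integral_fun_fst (fun x : ℝ => x ^ 2), integral_fun_snd (fun x : ℝ => x ^ 2), hv]
  norm_num

section Correlation

variable {Ω : Type*} [MeasurableSpace Ω] {μ : Measure Ω}

lemma integral_mul_conj_of_iIndepFun {ι : Type*} [DecidableEq ι] {G : ι → Ω → ℂ}
    (hG : ∀ p, HasLaw (G p) stdComplexGaussian μ) (hind : iIndepFun G μ) (x y : ι) :
    ∫ ω, G x ω * starRingEnd ℂ (G y ω) ∂μ = if x = y then 1 else 0 := by
  split_ifs with h
  · rw [← h, ← integral_mul_conj_stdComplexGaussian, ← (hG x).map_eq,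
      integral_map (hG x).aemeasurable (by fun_prop)]
  · have h0 : ∫ ω, G x ω ∂μ = 0 := by
      rw [← integral_id_stdComplexGaussian, ← (hG x).map_eq,
        integral_map (hG x).aemeasurable (by fun_prop)]
    have hc : Measurable (starRingEnd ℂ) := Complex.continuous_conj.measurable
    have h2 := ((hind.indepFun h).comp measurable_id hc).integral_fun_mul_eq_mul_integral
      (hG x).aemeasurable.aestronglyMeasurable
      (hc.comp_aemeasurable (hG y).aemeasurable).aestronglyMeasurable
    simp only [Function.comp_def, id] at h2
    rw [h2, h0, zero_mul]

lemma integrable_mul_conj {ι : Type*} {G : ι → Ω → ℂ}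
    (hG : ∀ p, HasLaw (G p) stdComplexGaussian μ) (x y : ι) :
    Integrable (fun ω => G x ω * starRingEnd ℂ (G y ω)) μ := by
  have hL : ∀ x, MemLp (G x) 2 μ := fun x => by
    have h := memLp_id_stdComplexGaussian
    rw [← (hG x).map_eq] at h
    exact h.comp_of_map (hG x).aemeasurable
  exact (hL x).integrable_mul (hL y).star

/-- The family G is orthonormal in L², so only the terms p = q with x = y survive. -/
lemma integral_linearCombination_mul_conj {ι κ : Type*} [Fintype κ] [DecidableEq ι]
    {G : ι × κ → Ω → ℂ} (hG : ∀ p, HasLaw (G p) stdComplexGaussian μ) (hind : iIndepFun G μ)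
    (α β : κ → ℂ) (x y : ι) :
    ∫ ω, (∑ p, α p * G (x, p) ω) * starRingEnd ℂ (∑ p, β p * G (y, p) ω) ∂μ =
      if x = y then ∑ p, α p * starRingEnd ℂ (β p) else 0 := by
  classical
  have h1 : ∀ ω, (∑ p, α p * G (x, p) ω) * starRingEnd ℂ (∑ p, β p * G (y, p) ω) =
      ∑ p, ∑ q, (α p * starRingEnd ℂ (β q)) * (G (x, p) ω * starRingEnd ℂ (G (y, q) ω)) := by
    intro ω
    rw [map_sum, Finset.sum_mul_sum]
    refine Finset.sum_congr rfl fun p _ => Finset.sum_congr rfl fun q _ => ?_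
    rw [map_mul]
    ring
  simp only [h1]
  rw [integral_finsetSum _ fun p _ => integrable_finsetSum _ fun q _ =>
    (integrable_mul_conj hG _ _).const_mul _]
  have h2 : ∀ p, ∫ ω, ∑ q, (α p * starRingEnd ℂ (β q)) *
      (G (x, p) ω * starRingEnd ℂ (G (y, q) ω)) ∂μ =
      if x = y then α p * starRingEnd ℂ (β p) else 0 := by
    intro p
    rw [integral_finsetSum _ fun q _ => (integrable_mul_conj hG _ _).const_mul _]
    simp only [integral_const_mul, integral_mul_conj_of_iIndepFun hG hind, Prod.mk.injEq, mul_ite,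
      mul_one, mul_zero]
    by_cases hxy : x = y <;> simp [hxy]
  simp only [h2]
  by_cases hxy : x = y <;> simp [hxy]

end Correlation

/-! The channel of one subcarrier -/

/-- The coefficient of the `p`-th tap in the channel of subcarrier `k`. -/
noncomputable def tapCoeff (N : ℕ) {L : ℕ} (σ : Fin L → ℝ) (k : ℕ) (p : Fin L) : ℂ :=
  (σ p : ℂ) * Complex.exp (-Complex.I * (2 * Real.pi * (k / N : ℝ) * (p : ℕ) : ℝ))

lemma subcarrier_apply (N : ℕ) {L Nr Nt : ℕ} (σ : Fin L → ℝ)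
    (H : Fin L → Matrix (Fin Nr) (Fin Nt) ℂ) (k : ℕ) (i : Fin Nr) (j : Fin Nt) :
    subcarrier N σ H k i j = ∑ p, tapCoeff N σ k p * H p i j := by
  simp [subcarrier, tapCoeff, Matrix.sum_apply]

lemma tapCoeff_eq (N : ℕ) {L : ℕ} (σ : Fin L → ℝ) (k : ℕ) (p : Fin L) :
    tapCoeff N σ k p =
      σ p * Complex.exp (((-(2 * Real.pi * (k / N) * (p : ℕ)) : ℝ) : ℂ) * Complex.I) := by
  rw [tapCoeff]
  congr 2
  push_cast
  ring

lemma sum_norm_tapCoeff_sq (N : ℕ) {L : ℕ} {σ : Fin L → ℝ} (hσ : ∑ p, σ p ^ 2 = 1) (k : ℕ) :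
    ∑ p, ‖tapCoeff N σ k p‖ ^ 2 = 1 := by
  rw [← hσ]
  refine Finset.sum_congr rfl fun p _ => ?_
  rw [tapCoeff_eq, norm_mul, Complex.norm_exp_ofReal_mul_I, mul_one, Complex.norm_real,
    Real.norm_eq_abs, sq_abs]

lemma sum_tapCoeff_mul_conj (N : ℕ) {L : ℕ} (σ : Fin L → ℝ) (k l : ℕ) :
    ∑ p, tapCoeff N σ k p * starRingEnd ℂ (tapCoeff N σ l p) =
      freqCorr N σ ((k : ℤ) - (l : ℤ)) := by
  refine Finset.sum_congr rfl fun p _ => ?_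
  rw [tapCoeff_eq, tapCoeff_eq, map_mul, Complex.conj_ofReal, ← Complex.exp_conj, map_mul,
    Complex.conj_I, Complex.conj_ofReal, mul_mul_mul_comm, ← Complex.exp_add, ← pow_two]
  congr 2
  push_cast
  ring

/-- Since σ is real, ρ_{-d} is the complex conjugate of ρ_d. -/
lemma norm_freqCorr_neg (N : ℕ) {L : ℕ} (σ : Fin L → ℝ) (d : ℤ) :
    ‖freqCorr N σ (-d)‖ = ‖freqCorr N σ d‖ := by
  rw [← Complex.norm_conj (freqCorr N σ d)]
  congr 1
  rw [freqCorr, freqCorr, map_sum]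
  refine Finset.sum_congr rfl fun p _ => ?_
  rw [map_mul, map_pow, Complex.conj_ofReal, ← Complex.exp_conj, map_mul, map_neg,
    Complex.conj_I, Complex.conj_ofReal]
  congr 2
  push_cast
  ring

lemma freqCorr_zero (N : ℕ) {L : ℕ} {σ : Fin L → ℝ} (hσ : ∑ p, σ p ^ 2 = 1) :
    freqCorr N σ 0 = 1 := by
  simp only [freqCorr]
  simp
  exact_mod_cast hσ

lemma sum_norm_sq_eq_trace {Nr Nt : ℕ} (G : Matrix (Fin Nr) (Fin Nt) ℂ) :
    Matrix.trace (G * G.conjTranspose) = ((∑ x : Fin Nr × Fin Nt, ‖G x.1 x.2‖ ^ 2 : ℝ) : ℂ) := by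
  rw [Fintype.sum_prod_type, Matrix.trace]
  push_cast
  refine Finset.sum_congr rfl fun i _ => ?_
  rw [Matrix.diag_apply, Matrix.mul_apply]
  refine Finset.sum_congr rfl fun j _ => ?_
  rw [Matrix.conjTranspose_apply, RCLike.star_def, Complex.mul_conj, Complex.normSq_eq_norm_sq]
  push_cast
  rfl

/-- For one receive antenna the matrix is 1 × 1; for one transmit antenna det(1 + AB) = det(1 + BA)
makes it so. -/
lemma det_one_add_smul_of_min_eq_one {Nr Nt : ℕ} (hm : min Nr Nt = 1) (c : ℂ)
    (G : Matrix (Fin Nr) (Fin Nt) ℂ) :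
    Matrix.det (1 + c • (G * G.conjTranspose)) = 1 + c * Matrix.trace (G * G.conjTranspose) := by
  have h : Nr = 1 ∨ Nt = 1 := by omega
  rcases h with rfl | rfl
  · rw [Matrix.det_fin_one, Matrix.trace_fin_one]
    simp
  · rw [← Matrix.smul_mul, Matrix.det_one_add_mul_comm, Matrix.det_fin_one, Matrix.trace_mul_comm,
      Matrix.trace_fin_one]
    simp

lemma mutualInfo_of_min_eq_one {Nr Nt : ℕ} (hm : min Nr Nt = 1) (γ : ℝ)
    (G : Matrix (Fin Nr) (Fin Nt) ℂ) :
    mutualInfo γ G =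
      Real.log (1 + (∑ x : Fin Nr × Fin Nt, ‖G x.1 x.2‖ ^ 2) / (Nt / γ)) / Real.log 2 := by
  rw [mutualInfo, det_one_add_smul_of_min_eq_one hm, sum_norm_sq_eq_trace, Real.logb]
  congr 2
  rw [← Complex.ofReal_mul, Complex.add_re, Complex.ofReal_re, Complex.one_re, div_div_eq_mul_div]
  ring

/-! The terms of the variance formula -/

lemma phi_congr_norm (Nt n : ℕ) (γ : ℝ) {ρ ρ' : ℂ} (h : ‖ρ‖ = ‖ρ'‖) :
    phi Nt n γ ρ = phi Nt n γ ρ' := by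
  simp only [phi, phiTerm, g₂, h]

/-- Identifies the mixture terms with those of φ: the binomial coefficient is (m+t)!/(m! t!), its
numerator is Γ(n+t) for n = m+1, and squaring the exponential produces the 2 in the exponent. -/
lemma negBinomialWeight_mul_sq {Nt m : ℕ} {γ : ℝ} (hγ : 0 < γ) {ρ : ℂ} (hρ : ‖ρ‖ < 1) (t : ℕ) :
    negBinomialWeight m (‖ρ‖ ^ 2) t * (Real.exp (Nt / γ / (1 - ‖ρ‖ ^ 2)) *
      ∑ h ∈ Finset.Icc 1 (m + t + 1), expIntegral h (Nt / γ / (1 - ‖ρ‖ ^ 2))) ^ 2 =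
    (1 - ‖ρ‖ ^ 2) ^ (m + 1) * Real.exp (2 * Nt / (γ * (1 - ‖ρ‖ ^ 2))) / m.factorial *
      phiTerm Nt (m + 1) γ ρ t := by
  have h1 : 1 - ‖ρ‖ ^ 2 ≠ 0 := by nlinarith [norm_nonneg ρ]
  have h2 : Real.Gamma (((m + 1 : ℕ) : ℝ) + t) = (m + t).factorial := by
    rw [← Real.Gamma_nat_eq_factorial]
    congr 1
    push_cast
    ring
  have h3 : ((t + m).choose m : ℝ) * (m.factorial * t.factorial) = (m + t).factorial := by
    rw [add_comm m t]
    have := Nat.add_choose_mul_factorial_mul_factorial t m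
    rw [← this, ← Nat.choose_symm_add]
    push_cast
    ring
  have h4 : Real.exp (2 * Nt / (γ * (1 - ‖ρ‖ ^ 2))) = Real.exp (Nt / γ / (1 - ‖ρ‖ ^ 2)) ^ 2 := by
    rw [← Real.exp_nat_mul]
    congr 1
    push_cast
    field_simp
  have hf : (m.factorial : ℝ) ≠ 0 := by positivity
  have hft : (t.factorial : ℝ) ≠ 0 := by positivity
  rw [phiTerm, h2, h4, g₂, ← h3, negBinomialWeight, div_div,
    show m + 1 + t = m + t + 1 by ring, pow_mul]
  field_simp

/-- A symmetric Toeplitz sum. Enlarging N adds one row and one column, each meeting every distance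
once. Doubling the sum from d = 0 counts the diagonal twice, hence the subtraction. -/
lemma sum_sum_dist {R : Type*} [CommRing R] (A : ℕ → R) (F : ℕ → ℕ → R)
    (hF : ∀ k d, F k (k + d) = A d) (hF' : ∀ k d, F (k + d) k = A d) (N : ℕ) :
    ∑ k ∈ Finset.range N, ∑ l ∈ Finset.range N, F k l =
      2 * ∑ d ∈ Finset.range N, ((N : R) - d) * A d - N * A 0 := by
  induction N with
  | zero => simp
  | succ N ih =>
    have h1 : ∑ l ∈ Finset.range N, F N l = ∑ d ∈ Finset.range N, A (d + 1) := by
      rw [← Finset.sum_range_reflect]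
      refine Finset.sum_congr rfl fun d hd => ?_
      rw [Finset.mem_range] at hd
      have := hF' (N - 1 - d) (d + 1)
      rwa [show N - 1 - d + (d + 1) = N by omega] at this
    have h2 : ∑ k ∈ Finset.range N, F k N = ∑ d ∈ Finset.range N, A (d + 1) := by
      rw [← Finset.sum_range_reflect]
      refine Finset.sum_congr rfl fun d hd => ?_
      rw [Finset.mem_range] at hd
      have := hF (N - 1 - d) (d + 1)
      rwa [show N - 1 - d + (d + 1) = N by omega] at this
    have h3 : F N N = A 0 := hF N 0
    have h4 : ∑ d ∈ Finset.range (N + 1), (((N + 1 : ℕ) : R) - d) * A d =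
        ∑ d ∈ Finset.range N, ((N : R) - d) * A d + ∑ d ∈ Finset.range (N + 1), A d := by
      have h5 : ∑ d ∈ Finset.range (N + 1), ((N : R) - d) * A d =
          ∑ d ∈ Finset.range N, ((N : R) - d) * A d := by
        rw [Finset.sum_range_succ]
        simp
      rw [← h5, ← Finset.sum_add_distrib]
      refine Finset.sum_congr rfl fun d _ => ?_
      push_cast
      ring
    rw [Finset.sum_range_succ, Finset.sum_range_succ (F N)]
    simp only [Finset.sum_range_succ (F _) N, Finset.sum_add_distrib]
    rw [ih, h1, h2, h3, h4, Finset.sum_range_succ' A]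
    push_cast
    ring

lemma sum_sum_dist_Icc {R : Type*} [CommRing R] (A : ℕ → R) (F : ℕ → ℕ → R)
    (hF : ∀ k d, F k (k + d) = A d) (hF' : ∀ k d, F (k + d) k = A d) {N : ℕ} (hN : 0 < N) :
    ∑ k ∈ Finset.range N, ∑ l ∈ Finset.range N, F k l =
      2 * ∑ d ∈ Finset.Icc 1 (N - 1), ((N : R) - d) * A d + N * A 0 := by
  have h : ∑ d ∈ Finset.range N, ((N : R) - d) * A d =
      N * A 0 + ∑ d ∈ Finset.Icc 1 (N - 1), ((N : R) - d) * A d := by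
    rw [Finset.range_eq_Ico, Finset.sum_eq_sum_Ico_succ_bot hN]
    have : Finset.Ico (0 + 1) N = Finset.Icc 1 (N - 1) := by
      ext d
      simp only [Finset.mem_Ico, Finset.mem_Icc]
      omega
    rw [this]
    simp
  rw [sum_sum_dist A F hF hF', h]
  ring

/-! ### Assembling the variance for the Rayleigh channel -/

section Rayleigh

variable {Ω : Type*} {L Nr Nt : ℕ}
  {H : Fin L → Ω → Matrix (Fin Nr) (Fin Nt) ℂ}

/-- The entries of the taps, indexed by position and tap. -/
def tapEntry (H : Fin L → Ω → Matrix (Fin Nr) (Fin Nt) ℂ) (x : (Fin Nr × Fin Nt) × Fin L)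
    (ω : Ω) : ℂ :=
  H x.2 ω x.1.1 x.1.2

/-- The squared norm of the channel of subcarrier `k`. -/
noncomputable def channelGain (N : ℕ) (σ : Fin L → ℝ)
    (H : Fin L → Ω → Matrix (Fin Nr) (Fin Nt) ℂ) (k : ℕ) (ω : Ω) : ℝ :=
  ∑ x : Fin Nr × Fin Nt, ‖∑ p, tapCoeff N σ k p * tapEntry H (x, p) ω‖ ^ 2

lemma ofdmMutualInfo_eq (hm : min Nr Nt = 1) (N : ℕ) (γ : ℝ) (σ : Fin L → ℝ) (ω : Ω) :
    ofdmMutualInfo N γ σ (fun p => H p ω) = 1 / (N * Real.log 2) *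
      ∑ k ∈ Finset.range N, Real.log (1 + channelGain N σ H k ω / (Nt / γ)) := by
  rw [ofdmMutualInfo, Finset.mul_sum, Finset.mul_sum]
  refine Finset.sum_congr rfl fun k _ => ?_
  rw [mutualInfo_of_min_eq_one hm]
  simp only [subcarrier_apply]
  rw [← mul_div_assoc, one_div_mul_eq_div, div_div, one_div_mul_eq_div]
  rfl

lemma card_eq_max_of_min_eq_one (hm : min Nr Nt = 1) :
    Fintype.card (Fin Nr × Fin Nt) = max Nr Nt := by
  have h : Nr = 1 ∧ 1 ≤ Nt ∨ Nt = 1 ∧ 1 ≤ Nr := by omega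
  rw [Fintype.card_prod, Fintype.card_fin, Fintype.card_fin]
  rcases h with ⟨rfl, h⟩ | ⟨rfl, h⟩
  · rw [one_mul, max_eq_right h]
  · rw [mul_one, max_eq_left h]

variable [MeasurableSpace Ω] {μ : Measure Ω}

lemma IsRayleighChannel.hasLaw_tapEntry (hH : IsRayleighChannel μ H)
    (x : (Fin Nr × Fin Nt) × Fin L) : HasLaw (tapEntry H x) stdComplexGaussian μ :=
  hH.hasLaw x.2 x.1.1 x.1.2

lemma IsRayleighChannel.iIndepFun_tapEntry (hH : IsRayleighChannel μ H) :
    iIndepFun (tapEntry H) μ :=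
  hH.indep.precomp (g := fun x : (Fin Nr × Fin Nt) × Fin L => (x.2, x.1.1, x.1.2))
    fun x y h => by
      simp only [Prod.mk.injEq] at h
      exact Prod.ext (Prod.ext h.2.1 h.2.2) h.1

variable [IsProbabilityMeasure μ]

lemma hasSum_phiTerm (hH : IsRayleighChannel μ H) {N m : ℕ} {σ : Fin L → ℝ}
    (hσ : ∑ p, σ p ^ 2 = 1) (hcard : Fintype.card (Fin Nr × Fin Nt) = m + 1) (hNt : 0 < Nt)
    {γ : ℝ} (hγ : 0 < γ) (k l : ℕ) (hρ : ‖freqCorr N σ ((l : ℤ) - (k : ℤ))‖ < 1) :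
    HasSum (phiTerm Nt (m + 1) γ (freqCorr N σ ((l : ℤ) - (k : ℤ))))
      (m.factorial * (∫ ω, Real.log (1 + channelGain N σ H k ω / (Nt / γ)) *
        Real.log (1 + channelGain N σ H l ω / (Nt / γ)) ∂μ) /
        ((1 - ‖freqCorr N σ ((l : ℤ) - (k : ℤ))‖ ^ 2) ^ (m + 1) *
          Real.exp (2 * Nt / (γ * (1 - ‖freqCorr N σ ((l : ℤ) - (k : ℤ))‖ ^ 2))))) := by
  have hb : (0 : ℝ) < Nt / γ := by positivity
  have h := hasSum_integral_log_mul_log hH.hasLaw_tapEntry hH.iIndepFun_tapEntry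
    (sum_norm_tapCoeff_sq N hσ k) (sum_norm_tapCoeff_sq N hσ l) (sum_tapCoeff_mul_conj N σ l k) hρ
    hcard hb
  simp only [negBinomialWeight_mul_sq hγ hρ] at h
  have h1 : 0 < 1 - ‖freqCorr N σ ((l : ℤ) - (k : ℤ))‖ ^ 2 := by
    nlinarith [norm_nonneg (freqCorr N σ ((l : ℤ) - (k : ℤ)))]
  have hf : (m.factorial : ℝ) ≠ 0 := by positivity
  set K := (1 - ‖freqCorr N σ ((l : ℤ) - (k : ℤ))‖ ^ 2) ^ (m + 1) *
    Real.exp (2 * Nt / (γ * (1 - ‖freqCorr N σ ((l : ℤ) - (k : ℤ))‖ ^ 2))) with hK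
  have hK0 : K ≠ 0 := by positivity
  have h2 := h.mul_left (m.factorial / K)
  have h3 (x : ℝ) : m.factorial / K * (K / m.factorial * x) = x := by field_simp
  simp only [h3] at h2
  rw [mul_div_right_comm]
  exact h2

/-- For |ρ| < 1 both remaining cases of φ come from the same series; for |ρ| = 1 the product moment
is the second moment of the logarithm under one Gamma law. -/
theorem Gamma_mul_integral_log_mul_log (hH : IsRayleighChannel μ H) {N m : ℕ} {σ : Fin L → ℝ}
    (hσ : ∑ p, σ p ^ 2 = 1) (hcard : Fintype.card (Fin Nr × Fin Nt) = m + 1) (hNt : 0 < Nt)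
    {γ : ℝ} (hγ : 0 < γ) (k l : ℕ) :
    ((Real.Gamma (m + 1 : ℕ) * ∫ ω, Real.log (1 + channelGain N σ H k ω / (Nt / γ)) *
        Real.log (1 + channelGain N σ H l ω / (Nt / γ)) ∂μ : ℝ) : ℂ) =
      phi Nt (m + 1) γ (freqCorr N σ ((l : ℤ) - (k : ℤ))) := by
  have hGamma : Real.Gamma ((m + 1 : ℕ) : ℝ) = m.factorial := by
    push_cast
    exact Real.Gamma_nat_eq_factorial m
  set ρ := freqCorr N σ ((l : ℤ) - (k : ℤ)) with hρdef
  have hρ : ‖ρ‖ ≤ 1 := norm_freqCorr_le_one N σ hσ _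
  rcases hρ.lt_or_eq with hlt | heq
  · have hs := hasSum_phiTerm hH hσ hcard hNt hγ k l hlt
    rw [← hρdef] at hs
    have h1 : 0 < 1 - ‖ρ‖ ^ 2 := by nlinarith [norm_nonneg ρ]
    rw [phi]
    split_ifs with h0
    -- At ρ = 0 the factor |ρ|^{2t} leaves only t = 0, and there `g₂` reduces to `g₁`.
    · have hs0 : HasSum (phiTerm Nt (m + 1) γ ρ) (phiTerm Nt (m + 1) γ ρ 0) :=
        hasSum_single 0 fun t ht => by simp [phiTerm, h0, ht]
      have h2 := hs.unique hs0
      have h3 : phiTerm Nt (m + 1) γ ρ 0 = m.factorial * g₁ Nt γ (m + 1) ^ 2 := by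
        simp only [phiTerm, g₂, h0]
        push_cast at hGamma
        simp [hGamma, g₁]
      rw [h3, h0] at h2
      simp only [ne_eq, OfNat.ofNat_ne_zero, not_false_eq_true, zero_pow, sub_zero, one_pow,
        one_mul, mul_one] at h2
      rw [hGamma, (div_eq_iff (Real.exp_pos _).ne').1 h2]
      congr 1
      ring
    · have hK : (1 - ‖ρ‖ ^ 2) ^ (m + 1) * Real.exp (2 * Nt / (γ * (1 - ‖ρ‖ ^ 2))) ≠ 0 := by
        positivity
      rw [hs.tsum_eq, hGamma, mul_div_cancel₀ _ hK]
  · have hb : (0 : ℝ) < Nt / γ := by positivity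
    rw [phi, if_neg (by rw [heq]; exact one_ne_zero), if_neg (by rw [heq]; exact lt_irrefl 1),
      ← integral_log_sq_gammaMeasure hNt hγ]
    congr 2
    exact integral_log_mul_log_of_norm_eq_one hH.hasLaw_tapEntry hH.iIndepFun_tapEntry
      (sum_norm_tapCoeff_sq N hσ k) (sum_norm_tapCoeff_sq N hσ l) (sum_tapCoeff_mul_conj N σ l k)
      heq hcard _

lemma memLp_log_channelGain (hH : IsRayleighChannel μ H) {N m : ℕ} {σ : Fin L → ℝ}
    (hσ : ∑ p, σ p ^ 2 = 1) (hcard : Fintype.card (Fin Nr × Fin Nt) = m + 1) {b : ℝ} (hb : 0 < b)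
    (k : ℕ) : MemLp (fun ω => Real.log (1 + channelGain N σ H k ω / b)) 2 μ :=
  memLp_log_sum_norm_sq hH.hasLaw_tapEntry hH.iIndepFun_tapEntry (sum_norm_tapCoeff_sq N hσ k)
    hcard hb

lemma memLp_ofdmMutualInfo (hH : IsRayleighChannel μ H) {N m : ℕ} {σ : Fin L → ℝ}
    (hσ : ∑ p, σ p ^ 2 = 1) (hm : min Nr Nt = 1)
    (hcard : Fintype.card (Fin Nr × Fin Nt) = m + 1) {γ : ℝ} (hγ : 0 < γ) :
    MemLp (fun ω => ofdmMutualInfo N γ σ (fun p => H p ω)) 2 μ := by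
  have hNt : 0 < Nt := by omega
  have hb : (0 : ℝ) < Nt / γ := by positivity
  simp only [ofdmMutualInfo_eq hm]
  exact (memLp_finsetSum _ fun k _ => memLp_log_channelGain hH hσ hcard hb k).const_mul _

theorem variance_ofdmMutualInfo (hH : IsRayleighChannel μ H) {N m : ℕ} {σ : Fin L → ℝ}
    (hσ : ∑ p, σ p ^ 2 = 1) (hm : min Nr Nt = 1)
    (hcard : Fintype.card (Fin Nr × Fin Nt) = m + 1) {γ : ℝ} (hγ : 0 < γ) :
    variance (fun ω => ofdmMutualInfo N γ σ (fun p => H p ω)) μ = (1 / (N * Real.log 2)) ^ 2 *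
      ((∑ k ∈ Finset.range N, ∑ l ∈ Finset.range N,
        ∫ ω, Real.log (1 + channelGain N σ H k ω / (Nt / γ)) *
          Real.log (1 + channelGain N σ H l ω / (Nt / γ)) ∂μ) -
        (N * (Real.exp (Nt / γ) * g₁ Nt γ (m + 1))) ^ 2) := by
  have hNt : 0 < Nt := by omega
  have hb : (0 : ℝ) < Nt / γ := by positivity
  have hL := memLp_log_channelGain (N := N) hH hσ hcard hb
  have hmean : ∀ k, ∫ ω, Real.log (1 + channelGain N σ H k ω / (Nt / γ)) ∂μ =
      Real.exp (Nt / γ) * g₁ Nt γ (m + 1) := fun k =>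
    integral_log_sum_norm_sq hH.hasLaw_tapEntry hH.iIndepFun_tapEntry (sum_norm_tapCoeff_sq N hσ k)
      hcard hb
  have hS : MemLp (fun ω => ∑ k ∈ Finset.range N,
      Real.log (1 + channelGain N σ H k ω / (Nt / γ))) 2 μ := memLp_finsetSum _ fun k _ => hL k
  have hLL (k l : ℕ) : Integrable (fun ω => Real.log (1 + channelGain N σ H k ω / (Nt / γ)) *
      Real.log (1 + channelGain N σ H l ω / (Nt / γ))) μ := (hL k).integrable_mul (hL l)
  simp only [ofdmMutualInfo_eq hm]
  rw [variance_const_mul, variance_eq_sub hS]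
  congr 2
  · simp only [Pi.pow_apply, pow_two, Finset.sum_mul_sum]
    rw [integral_finsetSum _ fun k _ => integrable_finsetSum _ fun l _ => hLL k l]
    refine Finset.sum_congr rfl fun k _ => ?_
    rw [integral_finsetSum _ fun l _ => hLL k l]
  · rw [integral_finsetSum _ fun k _ => (hL k).integrable (by norm_num)]
    simp [hmean]

theorem sum_sum_integral_log_mul_log (hH : IsRayleighChannel μ H) {N m : ℕ} {σ : Fin L → ℝ}
    (hσ : ∑ p, σ p ^ 2 = 1) (hcard : Fintype.card (Fin Nr × Fin Nt) = m + 1) (hNt : 0 < Nt)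
    (hN : 0 < N) {γ : ℝ} (hγ : 0 < γ) :
    ((Real.Gamma (m + 1 : ℕ) * ∑ k ∈ Finset.range N, ∑ l ∈ Finset.range N,
        ∫ ω, Real.log (1 + channelGain N σ H k ω / (Nt / γ)) *
          Real.log (1 + channelGain N σ H l ω / (Nt / γ)) ∂μ : ℝ) : ℂ) =
      2 * ∑ d ∈ Finset.Icc 1 (N - 1), ((N : ℂ) - d) * phi Nt (m + 1) γ (freqCorr N σ d) +
        N * (((2 * Real.exp (Nt / γ) * (Nt / γ) ^ (m + 1) : ℝ) : ℂ) * meijerSum Nt (m + 1) γ) := by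
  have h0 : phi Nt (m + 1) γ (freqCorr N σ ((0 : ℕ) : ℤ)) =
      ((2 * Real.exp (Nt / γ) * (Nt / γ) ^ (m + 1) : ℝ) : ℂ) * meijerSum Nt (m + 1) γ := by
    rw [Nat.cast_zero, freqCorr_zero N hσ, phi, if_neg (by simp), if_neg (by simp)]
  rw [← h0, ← sum_sum_dist_Icc (fun d => phi Nt (m + 1) γ (freqCorr N σ d))
    (fun k l => phi Nt (m + 1) γ (freqCorr N σ ((l : ℤ) - (k : ℤ)))) ?_ ?_ hN]
  · simp only [← Gamma_mul_integral_log_mul_log hH hσ hcard hNt hγ]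
    push_cast
    simp only [Finset.mul_sum]
  · intro k d
    simp
  · intro k d
    refine phi_congr_norm _ _ _ ?_
    rw [← norm_freqCorr_neg]
    congr 2
    push_cast
    ring

end Rayleigh

end OFDM

theorem mainTheorem4 {Ω : Type*} [MeasurableSpace Ω] (μ : MeasureTheory.Measure Ω)
    [MeasureTheory.IsProbabilityMeasure μ]
    (N L Nr Nt n : ℕ) (γ : ℝ) (σ : Fin L → ℝ) (H : Fin L → Ω → Matrix (Fin Nr) (Fin Nt) ℂ)
    (hN : 0 < N) (hm : min Nr Nt = 1) (hn : n = max Nr Nt) (hn1 : 1 < n)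
    (hγ : 0 < γ) (hσ : ∑ p, σ p ^ 2 = 1) (hH : OFDM.IsRayleighChannel μ H) :
    -- `freqCorr` is the correlation coefficient between the channel entries of two subcarriers
    (∀ k ∈ Finset.range N, ∀ l ∈ Finset.range N, ∀ (i i' : Fin Nr) (j j' : Fin Nt),
      ∫ ω, OFDM.subcarrier N σ (fun p => H p ω) k i j *
          starRingEnd ℂ (OFDM.subcarrier N σ (fun p => H p ω) l i' j') ∂μ =
        if i = i' ∧ j = j' then OFDM.freqCorr N σ ((k : ℤ) - (l : ℤ)) else 0) ∧
    -- the variance exists, and the series in the formula converge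
    MeasureTheory.MemLp (fun ω => OFDM.ofdmMutualInfo N γ σ (fun p => H p ω)) 2 μ ∧
    (∀ d ∈ Finset.Icc 1 (N - 1), 0 < ‖OFDM.freqCorr N σ d‖ → ‖OFDM.freqCorr N σ d‖ < 1 →
      Summable (OFDM.phiTerm Nt n γ (OFDM.freqCorr N σ d))) ∧
    ((ProbabilityTheory.variance (fun ω => OFDM.ofdmMutualInfo N γ σ (fun p => H p ω)) μ : ℝ) : ℂ) =
      ((Real.logb 2 (Real.exp 1) ^ 2 / Real.Gamma n : ℝ) : ℂ) *
        (2 / (N : ℂ) ^ 2 *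
            ∑ d ∈ Finset.Icc 1 (N - 1), ((N : ℂ) - (d : ℂ)) * OFDM.phi Nt n γ (OFDM.freqCorr N σ d)
          - ((Real.Gamma n * Real.exp (2 * Nt / γ) * OFDM.g₁ Nt γ n ^ 2 : ℝ) : ℂ)
          + ((2 * Real.exp (Nt / γ) / N * (Nt / γ) ^ n : ℝ) : ℂ) * OFDM.meijerSum Nt n γ) := by
  obtain ⟨m, rfl⟩ : ∃ m, n = m + 1 := ⟨n - 1, by omega⟩
  have hNt : 0 < Nt := by omega
  have hcard : Fintype.card (Fin Nr × Fin Nt) = m + 1 := by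
    rw [OFDM.card_eq_max_of_min_eq_one hm, hn]
  refine ⟨fun k _ l _ i i' j j' => ?_, OFDM.memLp_ofdmMutualInfo hH hσ hm hcard hγ,
    fun d _ _ hd => ?_, ?_⟩
  · have h := OFDM.integral_linearCombination_mul_conj hH.hasLaw_tapEntry hH.iIndepFun_tapEntry
      (OFDM.tapCoeff N σ k) (OFDM.tapCoeff N σ l) (i, j) (i', j')
    rw [OFDM.sum_tapCoeff_mul_conj] at h
    simp only [OFDM.subcarrier_apply]
    simp only [Prod.mk.injEq] at h
    exact h
  -- The pair of subcarriers 0 and d realises ρ_d, so summability follows from its product moment.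
  · have h := OFDM.hasSum_phiTerm (N := N) hH hσ hcard hNt hγ 0 d (by simpa using hd)
    simpa using h.summable
  · have hGamma : Real.Gamma ((m + 1 : ℕ) : ℝ) ≠ 0 := (Real.Gamma_pos_of_pos (by positivity)).ne'
    have hlog : Real.log 2 ≠ 0 := (Real.log_pos one_lt_two).ne'
    have hNC : (N : ℂ) ≠ 0 := by exact_mod_cast hN.ne'
    have hGC : (Real.Gamma ((m + 1 : ℕ) : ℝ) : ℂ) ≠ 0 := by exact_mod_cast hGamma
    have hlC : (Real.log 2 : ℂ) ≠ 0 := by exact_mod_cast hlog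
    have hsum := OFDM.sum_sum_integral_log_mul_log hH hσ hcard hNt hN hγ
    rw [OFDM.variance_ofdmMutualInfo hH hσ hm hcard hγ]
    set S : ℝ := ∑ k ∈ Finset.range N, ∑ l ∈ Finset.range N,
      ∫ ω, Real.log (1 + OFDM.channelGain N σ H k ω / (Nt / γ)) *
        Real.log (1 + OFDM.channelGain N σ H l ω / (Nt / γ)) ∂μ
    have hexp : Real.exp (2 * Nt / γ) = Real.exp (Nt / γ) ^ 2 := by
      rw [← Real.exp_nat_mul]
      congr 1
      push_cast
      ring
    have hlogb : Real.logb 2 (Real.exp 1) = 1 / Real.log 2 := by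
      rw [Real.logb, Real.log_exp]
    rw [hexp, hlogb]
    simp only [Complex.ofReal_mul, Complex.ofReal_div, Complex.ofReal_pow, Complex.ofReal_sub,
      Complex.ofReal_one, Complex.ofReal_natCast, Complex.ofReal_ofNat] at hsum ⊢
    -- Dividing by Γ(n) isolates the double sum. After the factor 1/N², the diagonal part keeps 1/N
    -- and the squared mean loses its N².
    have hS : (S : ℂ) = (2 * ∑ d ∈ Finset.Icc 1 (N - 1), ((N : ℂ) - d) *
        OFDM.phi Nt (m + 1) γ (OFDM.freqCorr N σ d) +
        N * (2 * (Real.exp (Nt / γ) : ℂ) * ((Nt : ℂ) / γ) ^ (m + 1) *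
          OFDM.meijerSum Nt (m + 1) γ)) / (Real.Gamma ((m + 1 : ℕ) : ℝ) : ℂ) := by
      rw [eq_div_iff hGC, mul_comm, hsum]
    rw [hS]
    field_simp
    ring
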